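/- **Notation.** Let $d\ge 1$, let $\mathbb{D}$ be the open unit disk, and let $\mathcal{H}_d$ be the set of holomorphic functions $\mathbb{D}^d\to\overline{\mathbb{D}}$ with the topology of uniform convergence on compact sets. Write $\mathbf{c}_0$ for the zero function. For $1\le j\le d$ and $r\in\overline{\mathbb{D}}$ define operators on $\mathcal{H}_d$ by $(\mathfrak{m}_jh)(z)=z_jh(z)$ and $(\mathfrak{g}_rh)(z)=\dfrac{h(z)+r}{1+\bar r\,h(z)}$, where $\mathfrak{g}_rh$ is understood to be the constant $r$ if $|r|=1$. The class $\mathcal{S}_d$ of Schur functions is the closure in $\mathcal{H}_d$ of the orbit of $\mathbf{c}_0$ under the semigroup generated by the operators $\mathfrak{g}_r\mathfrak{m}_j$ with $|r|<1$, $1\le j\le d$. Schur parameters $r=(r_n)_{n\ge0}$ in $\overline{\mathbb{D}}$ and a variable allocation map $\nu:\mathbb{Z}_{>0}\to\{1,\dots,d\}$ of $f\in\mathcal{S}_d$ are sequences obtained as follows, with auxiliary functions $h_n\in\mathcal{S}_d$: $h_0=f$ and, for all $n\ge0$, $r_n=h_n(0)$ and $h_n=\mathfrak{g}_{r_n}\mathfrak{m}_{\nu_{n+1}}h_{n+1}$,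 where $\nu_{n+1}=1$ and $h_{n+1}=\mathbf{c}_0$ if $h_n$ is constant. The convergents are $f_n=\mathfrak{g}_{r_0}\mathfrak{m}_{\nu_1}\mathfrak{g}_{r_1}\cdots\mathfrak{m}_{\nu_n}\mathfrak{g}_{r_n}\mathbf{c}_0$. For integers $p,q\ge 0$ the scattering polynomial $\varphi^{(p,q)}:\mathbb{C}\to\mathbb{C}$ is $\varphi^{(p,0)}(z)=z^p$; $\varphi^{(0,q)}=0$ for $q\ge1$; and for $p,q\ge1$ $$\varphi^{(p,q)}(z)=\frac{(-1)^p}{q\,(p+q-1)!}(1-z\bar z)\frac{\partial^{p+q}}{\partial\bar z^p\,\partial z^q}(1-z\bar z)^{p+q-1}.$$ Let $A$ be the set of finitely supported $\alpha:\mathbb{Z}_{>0}\to\mathbb{Z}_{\ge0}$, and for $n\ge0$ let $A_n\subset A$ be the set of those supported in $\{1,\dots,n\}$. For $\alpha\in A$ put $$c_\alpha(r)=\varphi^{(1,\alpha_1)}(r_0)\prod_{j=1}^{n}\varphi^{(\alpha_j,\alpha_{j+1})}(r_j),\qquad (z\circ\nu)^\alpha=\prod_{j\ge1}z_{\nu_j}^{\alpha_j},$$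 where $n=\max\operatorname{supp}\alpha$ ($n=0$ if $\alpha=0$). **Theorem.** Let $f\in\mathcal{S}_d$. Then $f$ has Schur parameters $r$ and a variable allocation map $\nu$ as above, and for every such choice of $r$ and $\nu$ the convergents satisfy $f_n\to f$ uniformly on compact subsets of $\mathbb{D}^d$, and $$f(z)=\sum_{\alpha\in A}c_\alpha(r)\,(z\circ\nu)^\alpha\qquad(z\in\mathbb{D}^d)$$ is the Taylor series of $f$, converging uniformly on compact subsets of $\mathbb{D}^d$, in the following sense. For every monomial $z^\beta=z_1^{\beta_1}\cdots z_d^{\beta_d}$ there are only finitely many $\alpha\in A$ with $(z\circ\nu)^\alpha=z^\beta$ and $c_\alpha(r)\ne0$, and $$f(z)=\sum_{\beta\in\mathbb{Z}_{\ge0}^d}\ \Bigl(\sum_{\alpha\in A:\ (z\circ\nu)^\alpha=z^\beta}c_\alpha(r)\Bigr)z^\beta ,$$ where the sum over $\beta$ converges unconditionally and uniformly on compact subsets of $\mathbb{D}^d$. Moreover, for every $n\ge 0$, $\sum_{\alpha\in A_n}c_\alpha(r)(z\circ\nu)^\alpha$ converges unconditionally and uniformly on compact subsets of $\mathbb{D}^d$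 to $f_n(z)$, so that the sums over $A_n$ tend to $f$ as well. -/

import Mathlib

open Filter Topology

noncomputable section

/-! ### Scattering polynomials and scattering weights

Sequences and multi-indices which the mathematics indexes by the positive integers are indexed
here by `ℕ`, shifted by one: `α i` stands for `α_{i+1}`, and `ν i` stands for `ν_{i+1}`.
The sequence `r` of Schur parameters is indexed by the non-negative integers, without shift. -/

/-- The Wirtinger derivative `∂/∂z = (∂/∂x - i ∂/∂y) / 2`. -/
def wirtinger (F : ℂ → ℂ) (z : ℂ) : ℂ :=
  (1 / 2) * (fderiv ℝ F z 1 - Complex.I * fderiv ℝ F z Complex.I)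

/-- The conjugate Wirtinger derivative `∂/∂z̄ = (∂/∂x + i ∂/∂y) / 2`. -/
def wirtingerBar (F : ℂ → ℂ) (z : ℂ) : ℂ :=
  (1 / 2) * (fderiv ℝ F z 1 + Complex.I * fderiv ℝ F z Complex.I)

/-- The scattering polynomial `φ^{(p,q)}`: it is `z ^ p` if `q = 0`, it is `0` if `p = 0 < q`, and
`(-1)^p / (q (p+q-1)!) (1 - z z̄) ∂^{p+q}/∂z̄^p∂z^q (1 - z z̄)^{p+q-1}` if `p, q ≥ 1`. -/
def scatteringPoly (p q : ℕ) (z : ℂ) : ℂ :=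
  if q = 0 then z ^ p
  else if p = 0 then 0
  else (-1) ^ p / ((q : ℂ) * ((p + q - 1).factorial : ℂ)) * (1 - z * star z) *
    (wirtingerBar^[p] (wirtinger^[q] fun w : ℂ => (1 - w * star w) ^ (p + q - 1))) z

/-- The scattering weight
`c_α(r) = φ^{(1,α_1)}(r_0) ∏_{j=1}^n φ^{(α_j,α_{j+1})}(r_j)`, where `n = max supp α`
(and `n = 0` if `α = 0`). -/
def scatteringWeight (α : ℕ →₀ ℕ) (r : ℕ → ℂ) : ℂ :=
  scatteringPoly 1 (α 0) (r 0) *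
    ∏ i ∈ Finset.range (α.support.sup fun i => i + 1),
      scatteringPoly (α i) (α (i + 1)) (r (i + 1))

/-- The set `A_n` of multi-indices with `supp α ⊆ {1, …, n}`. (The union `A` of these sets is the
type `ℕ →₀ ℕ` itself.) -/
def indexSet (n : ℕ) : Set (ℕ →₀ ℕ) := {α | ∀ i, n ≤ i → α i = 0}

/-- The monomial `(z ∘ ν)^α = z_{ν_1}^{α_1} z_{ν_2}^{α_2} ⋯`. -/
def allocMonomial {d : ℕ} (ν : ℕ → Fin d) (α : ℕ →₀ ℕ) (z : Fin d → ℂ) : ℂ :=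
  α.prod fun i a => z (ν i) ^ a

/-! ### Multivariate Schur functions

A function on the polydisk is represented by a function on `Fin d → ℂ`, of which only the values
on the polydisk matter. -/

/-- The open unit polydisk. -/
def polydisk (d : ℕ) : Set (Fin d → ℂ) := {z | ∀ i, ‖z i‖ < 1}

/-- The class `H_d` of holomorphic functions from the open polydisk to the closed unit disk. -/
def holClass (d : ℕ) : Set ((Fin d → ℂ) → ℂ) :=
  {h | DifferentiableOn ℂ h (polydisk d) ∧ ∀ z ∈ polydisk d, ‖h z‖ ≤ 1}

/-- The operator of multiplication by the `j`-th variable. -/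
def mulOp {d : ℕ} (j : Fin d) (h : (Fin d → ℂ) → ℂ) : (Fin d → ℂ) → ℂ := fun z => z j * h z

/-- The operator of composition with `ξ ↦ (ξ + r) / (1 + r̄ ξ)`, which is understood to be the
constant `r` if `|r| = 1`. -/
def mobOp {d : ℕ} (r : ℂ) (h : (Fin d → ℂ) → ℂ) : (Fin d → ℂ) → ℂ :=
  fun z => if ‖r‖ = 1 then r else (h z + r) / (1 + star r * h z)

/-- The orbit of the zero function under the semigroup generated by the operators
`mobOp r ∘ mulOp j` with `|r| < 1`. (For `d ≥ 1` the zero function is itself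
the image of the zero function under `mobOp 0 ∘ mulOp j`.) -/
inductive SchurOrbit (d : ℕ) : ((Fin d → ℂ) → ℂ) → Prop
  | zero : SchurOrbit d (fun _ => 0)
  | step (r : ℂ) (j : Fin d) (h : (Fin d → ℂ) → ℂ) (hr : ‖r‖ < 1) (hh : SchurOrbit d h) :
      SchurOrbit d (mobOp r (mulOp j h))

/-- The class `S_d` of Schur functions: the closure of the orbit of the zero function in `H_d`, with
respect to the topology of uniform convergence on compact subsets of the polydisk. -/
def schurClass (d : ℕ) : Set ((Fin d → ℂ) → ℂ) :=
  {f | f ∈ holClass d ∧ ∀ K ⊆ polydisk d, IsCompact K → ∀ ε : ℝ, 0 < ε →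
    ∃ g, SchurOrbit d g ∧ ∀ z ∈ K, ‖g z - f z‖ < ε}

/-! ### Continued fractions -/

/-- `r` and `ν` are the Schur parameters and a variable allocation map of `f`, obtained by running
the continued fraction algorithm on `f`, with successive functions `h n`:
`h 0 = f`, `r n = h n (0)`, `h n = mobOp (r n) (mulOp ν_{n+1} (h (n+1)))` on the polydisk, and
if `h n` is constant, then `ν_{n+1}` is the first index and `h (n+1)` is the zero function. -/
structure IsContinuedFraction {d : ℕ} [NeZero d] (f : (Fin d → ℂ) → ℂ) (r : ℕ → ℂ)
    (ν : ℕ → Fin d) (h : ℕ → (Fin d → ℂ) → ℂ) : Prop where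
  start : h 0 = f
  schur : ∀ n, h n ∈ schurClass d
  param : ∀ n, r n = h n 0
  step : ∀ n, Set.EqOn (h n) (mobOp (r n) (mulOp (ν n) (h (n + 1)))) (polydisk d)
  const : ∀ n, (∃ c : ℂ, ∀ z ∈ polydisk d, h n z = c) →
    ν n = 0 ∧ ∀ z ∈ polydisk d, h (n + 1) z = 0

/-- The operator
`mobOp r_0 ∘ mulOp ν_1 ∘ mobOp r_1 ∘ ⋯ ∘ mulOp ν_n ∘ mobOp r_n`. -/
def convergentOp {d : ℕ} (r : ℕ → ℂ) (ν : ℕ → Fin d) :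
    ℕ → ((Fin d → ℂ) → ℂ) → ((Fin d → ℂ) → ℂ)
  | 0, h => mobOp (r 0) h
  | n + 1, h => convergentOp r ν n (mulOp (ν n) (mobOp (r (n + 1)) h))

/-- The `n`-th convergent, that is `convergentOp r ν n` applied to the zero function. -/
def convergent {d : ℕ} (r : ℕ → ℂ) (ν : ℕ → Fin d) (n : ℕ) : (Fin d → ℂ) → ℂ :=
  convergentOp r ν n (fun _ => 0)

end

/-! The bridge between weights and functions is that `φ^{(p,q)}(r)` is the coefficient of `ξ^q` in
`((ξ + r) / (1 + r̄ ξ))^p` (`coeff_mobSeries_pow`). Expanding the outermost Möbius layer of `f_n^p`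
in powers of `z_{ν_1} w`, with `w` the shorter inner convergent, and then each `w^q` by induction,
produces exactly the sum over `A_n` (`hasSum_chainWeight`). Cauchy's estimate (`norm_coeff_le_one`)
bounds every weight by 1, so these sums converge absolutely.

The convergents tend to `f` by contraction: Möbius maps preserve the pseudo-hyperbolic distance,
while multiplication by a number of modulus at most `s < 1` shrinks it by the factor `2s / (1 + s²)
< 1`, even up to the boundary of the disk. So `f` and `f_n` are at distance at most the `n`-th power
of that factor (`pseudoDistLE_convergent`).

For the Taylor series, `φ^{(0,q)} = 0` for `q ≥ 1` forces the support of a contributing `α` to be an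
initial segment. Hence only finitely many `α` give `z^β`, and the coefficient of `z^β` in `f_n` is
constant for `n ≥ |β|`. Cauchy's estimate for `f_n` bounds these coefficients by 1, and dominated
convergence passes to the limit (`hasSum_taylorCoeff_univ`).

Existence of the expansion reduces to one step (`exists_schur_step_of_norm_lt_one`): approximate by
orbit elements, fix the outermost variable by pigeonhole, invert the Möbius map, and divide by the
variable using the maximum principle. -/

noncomputable section

/-! ### Explicit form of the scattering polynomials -/

theorem fderiv_sum_monomial (s : Finset ℕ) (c : ℕ → ℂ) (a b : ℕ → ℕ) (z v : ℂ) :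
    fderiv ℝ (fun w : ℂ => ∑ k ∈ s, c k * (w ^ a k * star w ^ b k)) z v =
      ∑ k ∈ s, c k * (a k * z ^ (a k - 1) * v * star z ^ b k +
        z ^ a k * (b k * star z ^ (b k - 1) * star v)) := by
  have hstar : HasFDerivAt (fun w : ℂ => star w) (Complex.conjCLE : ℂ →L[ℝ] ℂ) z :=
    (Complex.conjCLE : ℂ →L[ℝ] ℂ).hasFDerivAt
  have hid : HasFDerivAt (fun w : ℂ => w) (ContinuousLinearMap.id ℝ ℂ) z := hasFDerivAt_id z
  have h : HasFDerivAt (fun w : ℂ => ∑ k ∈ s, c k * (w ^ a k * star w ^ b k)) _ z :=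
    HasFDerivAt.fun_sum fun k _ =>
      (((hid.pow (a k)).mul (hstar.pow (b k))).const_mul (c k))
  rw [h.fderiv, sum_apply]
  refine Finset.sum_congr rfl fun k _ => ?_
  simp
  ring

/-- Sums of this shape are stable under both Wirtinger derivatives, so iterates can be computed
termwise. Truncation in `a k - 1` is harmless because of the factor `a k`. -/
theorem wirtinger_sum_monomial (s : Finset ℕ) (c : ℕ → ℂ) (a b : ℕ → ℕ) :
    (wirtinger fun w : ℂ => ∑ k ∈ s, c k * (w ^ a k * star w ^ b k)) =
      fun w => ∑ k ∈ s, c k * a k * (w ^ (a k - 1) * star w ^ b k) := by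
  funext z
  rw [wirtinger, fderiv_sum_monomial, fderiv_sum_monomial, Finset.mul_sum,
    ← Finset.sum_sub_distrib, Finset.mul_sum]
  refine Finset.sum_congr rfl fun k _ => ?_
  have hI : star Complex.I = -Complex.I := Complex.conj_I
  rw [hI, star_one]
  linear_combination (-1 / 2 * c k * (a k * z ^ (a k - 1) * star z ^ b k -
    z ^ a k * (b k * star z ^ (b k - 1)))) * Complex.I_mul_I

theorem wirtingerBar_sum_monomial (s : Finset ℕ) (c : ℕ → ℂ) (a b : ℕ → ℕ) :
    (wirtingerBar fun w : ℂ => ∑ k ∈ s, c k * (w ^ a k * star w ^ b k)) =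
      fun w => ∑ k ∈ s, c k * b k * (w ^ a k * star w ^ (b k - 1)) := by
  funext z
  rw [wirtingerBar, fderiv_sum_monomial, fderiv_sum_monomial, Finset.mul_sum,
    ← Finset.sum_add_distrib, Finset.mul_sum]
  refine Finset.sum_congr rfl fun k _ => ?_
  have hI : star Complex.I = -Complex.I := Complex.conj_I
  rw [hI, star_one]
  linear_combination (1 / 2 * c k * (a k * z ^ (a k - 1) * star z ^ b k -
    z ^ a k * (b k * star z ^ (b k - 1)))) * Complex.I_mul_I

theorem iterate_wirtinger_sum_monomial (s : Finset ℕ) (c : ℕ → ℂ) (a b : ℕ → ℕ) (n : ℕ) :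
    (wirtinger^[n] fun w : ℂ => ∑ k ∈ s, c k * (w ^ a k * star w ^ b k)) =
      fun w => ∑ k ∈ s, c k * (a k).descFactorial n * (w ^ (a k - n) * star w ^ b k) := by
  induction n with
  | zero => simp
  | succ n ih =>
    rw [Function.iterate_succ_apply', ih, wirtinger_sum_monomial]
    funext w
    refine Finset.sum_congr rfl fun k _ => ?_
    rw [Nat.descFactorial_succ, Nat.sub_sub]
    push_cast
    ring

theorem iterate_wirtingerBar_sum_monomial (s : Finset ℕ) (c : ℕ → ℂ) (a b : ℕ → ℕ) (n : ℕ) :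
    (wirtingerBar^[n] fun w : ℂ => ∑ k ∈ s, c k * (w ^ a k * star w ^ b k)) =
      fun w => ∑ k ∈ s, c k * (b k).descFactorial n * (w ^ a k * star w ^ (b k - n)) := by
  induction n with
  | zero => simp
  | succ n ih =>
    rw [Function.iterate_succ_apply', ih, wirtingerBar_sum_monomial]
    funext w
    refine Finset.sum_congr rfl fun k _ => ?_
    rw [Nat.descFactorial_succ, Nat.sub_sub]
    push_cast
    ring

theorem scatteringPoly_zero_right (p : ℕ) (z : ℂ) : scatteringPoly p 0 z = z ^ p := by
  simp [scatteringPoly]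

theorem scatteringPoly_zero_left {q : ℕ} (hq : q ≠ 0) (z : ℂ) : scatteringPoly 0 q z = 0 := by
  simp [scatteringPoly, hq]

/-- For `j ≤ p` both sides are `(p+q+1)! p! / (j! (p-j)!)`; for `j > p` both vanish. -/
theorem choose_mul_descFactorial_add (p q j : ℕ) :
    ((p + q + 1).choose (q + 1 + j) * (q + 1 + j).descFactorial (q + 1)) * p.factorial =
      (p + q + 1).factorial * p.choose j := by
  rcases le_or_gt j p with hj | hj
  · have h1 := Nat.choose_mul_factorial_mul_factorial (show q + 1 + j ≤ p + q + 1 by omega)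
    have h2 := Nat.choose_mul_factorial_mul_factorial hj
    have h3 := Nat.factorial_mul_descFactorial (show q + 1 ≤ q + 1 + j by omega)
    rw [show p + q + 1 - (q + 1 + j) = p - j by omega] at h1
    rw [show q + 1 + j - (q + 1) = j by omega] at h3
    have hpos : 0 < j.factorial * (p - j).factorial := by positivity
    refine Nat.eq_of_mul_eq_mul_right hpos ?_
    rw [← h1, ← h3, ← h2]
    ring
  · rw [Nat.choose_eq_zero_of_lt hj, Nat.choose_eq_zero_of_lt (by omega)]
    simp

/-- Binomial expansion followed by termwise differentiation. The factor `q + 1` prepares the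
comparison with the coefficients of a derivative. Where `q + j - p` truncates, the second binomial
coefficient is zero. -/
theorem scatteringPoly_succ_succ (p q : ℕ) (z : ℂ) :
    ((q : ℂ) + 1) * scatteringPoly (p + 1) (q + 1) z =
      ((p : ℂ) + 1) * (1 - z * star z) * ∑ j ∈ Finset.range (p + 1),
        (p.choose j : ℂ) * (q + 1 + j).choose (p + 1) * (-1) ^ (p + q + j) *
          (z ^ j * star z ^ (q + j - p)) := by
  have hexp : (fun w : ℂ => (1 - w * star w) ^ (p + q + 1)) =
      fun w => ∑ k ∈ Finset.range (p + q + 2),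
        ((-1 : ℂ) ^ k * (p + q + 1).choose k) * (w ^ k * star w ^ k) := by
    funext w
    rw [sub_eq_neg_add, add_pow]
    refine Finset.sum_congr rfl fun k _ => ?_
    rw [neg_pow, mul_pow]
    ring
  have hcast : ((q : ℂ) + 1) ≠ 0 := by exact_mod_cast Nat.succ_ne_zero q
  have hfac : (((p + q + 1).factorial : ℕ) : ℂ) ≠ 0 := by
    exact_mod_cast Nat.factorial_ne_zero _
  rw [scatteringPoly, if_neg (Nat.succ_ne_zero q), if_neg (Nat.succ_ne_zero p),
    show p + 1 + (q + 1) - 1 = p + q + 1 by omega, hexp, iterate_wirtinger_sum_monomial,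
    iterate_wirtingerBar_sum_monomial, show p + q + 2 = (q + 1) + (p + 1) by omega]
  beta_reduce
  -- The first `q + 1` terms have degree at most `q` in `w` and are killed by `q + 1` derivatives.
  rw [Finset.sum_range_add _ (q + 1) (p + 1), Finset.sum_eq_zero, zero_add,
    Finset.mul_sum, Finset.mul_sum, Finset.mul_sum]
  · refine Finset.sum_congr rfl fun j _ => ?_
    have h1 : ((p + q + 1).choose (q + 1 + j) : ℂ) * (q + 1 + j).descFactorial (q + 1) *
        p.factorial = (p + q + 1).factorial * p.choose j := by
      exact_mod_cast choose_mul_descFactorial_add p q j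
    have h2 : ((q + 1 + j).descFactorial (p + 1) : ℂ) =
        (p + 1) * p.factorial * (q + 1 + j).choose (p + 1) := by
      rw [Nat.descFactorial_eq_factorial_mul_choose, Nat.factorial_succ]
      push_cast
      ring
    rw [show q + 1 + j - (q + 1) = j by omega, show q + 1 + j - (p + 1) = q + j - p by omega, h2]
    push_cast
    field_simp
    linear_combination ((-1 : ℂ) ^ (p + q + j) * (1 - z * star z) *
      (q + 1 + j).choose (p + 1) * z ^ j * star z ^ (q + j - p)) * h1
  · intro k hk
    rw [Nat.descFactorial_eq_zero_iff_lt.mpr (Finset.mem_range.mp hk)]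
    simp

/-! ### The power series of a Möbius transformation -/

open PowerSeries in
/-- The power series at `0` of `ξ ↦ (ξ + r) / (1 + r̄ ξ)`. -/
def mobSeries (r : ℂ) : PowerSeries ℂ :=
  PowerSeries.mk fun q => if q = 0 then r else (1 - r * star r) * (-star r) ^ (q - 1)

open PowerSeries in
theorem mobSeries_mul (r : ℂ) : mobSeries r * (1 + C (star r) * X) = C r + X := by
  ext n
  rw [mul_add, mul_one, ← mul_assoc, mul_comm _ (C (star r)), mul_assoc]
  rcases n with _ | _ | n
  · simp [mobSeries]
  · simp [mobSeries, coeff_succ_mul_X, coeff_X]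
    ring
  · simp [mobSeries, coeff_succ_mul_X, coeff_X]
    ring_nf

open PowerSeries in
theorem mk_choose_mul_one_add_pow (s : ℂ) (p : ℕ) :
    (mk fun n => ((p + n).choose p : ℂ) * (-s) ^ n) * (1 + C s * X) ^ (p + 1) = 1 := by
  have h := congrArg (rescale (-s)) (mk_add_choose_mul_one_sub_pow_eq_one ℂ p)
  rw [map_mul, map_pow, map_sub, map_one, rescale_X] at h
  have h1 : (1 : PowerSeries ℂ) - C (-s) * X = 1 + C s * X := by simp
  rw [h1] at h
  convert h using 2
  ext n
  simp [coeff_rescale, mul_comm]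

open PowerSeries in
-- With `u = 1 + r̄ X`, the quotient rule gives `G' u² = 1 - r r̄`. Differentiating exposes this
-- factor, which matches `1 - z z̄` in the scattering polynomial, and `H` is the inverse of
-- `u^(p+2)`.
theorem derivative_mobSeries_pow (r : ℂ) (p : ℕ) :
    derivative ℂ (mobSeries r ^ (p + 1)) =
      C ((p + 1) * (1 - r * star r)) * ((C r + X) ^ p *
        mk fun n => ((p + 1 + n).choose (p + 1) : ℂ) * (-star r) ^ n) := by
  set G := mobSeries r
  set u : PowerSeries ℂ := 1 + C (star r) * X
  set H : PowerSeries ℂ := mk fun n => ((p + 1 + n).choose (p + 1) : ℂ) * (-star r) ^ n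
  have hG : G * u = C r + X := mobSeries_mul r
  have hH : H * u ^ (p + 2) = 1 := mk_choose_mul_one_add_pow (star r) (p + 1)
  have hu : derivative ℂ u = C (star r) := by
    simp [u]
  have hD : derivative ℂ G * u + G * C (star r) = 1 := by
    have h := congrArg (derivative ℂ) hG
    rw [Derivation.leibniz, hu] at h
    simp only [smul_eq_mul, map_add, derivative_C, derivative_X, zero_add] at h
    rw [← h]; ac_rfl
  have hD2 : derivative ℂ G * u ^ 2 = C (1 - r * star r) := by
    have : derivative ℂ G * u ^ 2 = u - C (star r) * (C r + X) := by
      rw [← hG]; linear_combination u * hD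
    rw [this, map_sub, map_mul, map_one]
    simp only [u]; ring
  have hpow : derivative ℂ (G ^ (p + 1)) = C ((p : ℂ) + 1) * G ^ p * derivative ℂ G := by
    rw [Derivation.leibniz_pow]
    simp [mul_assoc]
  calc derivative ℂ (G ^ (p + 1)) = derivative ℂ (G ^ (p + 1)) * (H * u ^ (p + 2)) := by
        rw [hH, mul_one]
    _ = C ((p : ℂ) + 1) * (G * u) ^ p * (derivative ℂ G * u ^ 2) * H := by
        rw [hpow, mul_pow]; ring
    _ = _ := by rw [hG, hD2, map_mul]; ring

open PowerSeries in
-- The generating function of the scattering polynomials. For `p, q ≥ 1` it follows by comparing `q`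
-- times both sides with the explicit formulas.
theorem coeff_mobSeries_pow (p q : ℕ) (r : ℂ) :
    coeff q (mobSeries r ^ p) = scatteringPoly p q r := by
  rcases q with _ | q
  · rw [scatteringPoly_zero_right, coeff_zero_eq_constantCoeff_apply, map_pow]
    simp [mobSeries, ← coeff_zero_eq_constantCoeff_apply]
  rcases p with _ | p
  · rw [scatteringPoly_zero_left (Nat.succ_ne_zero q), pow_zero, coeff_one]
    simp
  have hcast : ((q : ℂ) + 1) ≠ 0 := by exact_mod_cast Nat.succ_ne_zero q
  refine mul_left_cancel₀ hcast ?_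
  rw [scatteringPoly_succ_succ, mul_comm, ← coeff_derivative, derivative_mobSeries_pow,
    coeff_C_mul, add_pow, Finset.sum_mul, map_sum]
  congr 1
  refine Finset.sum_congr rfl fun j hj => ?_
  have hj : j ≤ p := Nat.lt_succ_iff.mp (Finset.mem_range.mp hj)
  rw [← map_pow, ← map_natCast (C (R := ℂ)), mul_assoc, mul_assoc, coeff_C_mul, mul_left_comm,
    coeff_C_mul, coeff_X_pow_mul']
  split_ifs with h
  · rw [coeff_mk, show p + 1 + (q - (p - j)) = q + 1 + j by omega,
      show q - (p - j) = q + j - p by omega, neg_pow]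
    have : (-1 : ℂ) ^ (p + q + j) = (-1) ^ (q + j - p) := by
      rw [show p + q + j = (q + j - p) + 2 * p by omega, pow_add, pow_mul]
      simp
    rw [this]
    ring
  · rw [Nat.choose_eq_zero_of_lt (show q + 1 + j < p + 1 by omega)]
    simp

/-- The power series `P` converges absolutely at `x`, with sum `v`. -/
def HasPowerSum (P : PowerSeries ℂ) (x v : ℂ) : Prop :=
  HasSum (fun n => PowerSeries.coeff n P * x ^ n) v

theorem HasPowerSum.mul {P Q : PowerSeries ℂ} {x v w : ℂ} (hP : HasPowerSum P x v)
    (hQ : HasPowerSum Q x w) : HasPowerSum (P * Q) x (v * w) := by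
  have hP' := hP.summable.norm
  have hQ' := hQ.summable.norm
  have h := tsum_mul_tsum_eq_tsum_sum_antidiagonal_of_summable_norm hP' hQ'
  have hs := (summable_norm_sum_mul_antidiagonal_of_summable_norm hP' hQ').of_norm
  have h2 := hs.hasSum
  rw [← h, hP.tsum_eq, hQ.tsum_eq] at h2
  unfold HasPowerSum
  convert! h2 using 2 with n
  rw [PowerSeries.coeff_mul, Finset.sum_mul]
  refine Finset.sum_congr rfl fun k hk => ?_
  rw [← Finset.HasAntidiagonal.mem_antidiagonal.mp hk, pow_add]
  ring

theorem HasPowerSum.pow {P : PowerSeries ℂ} {x v : ℂ} (hP : HasPowerSum P x v) (p : ℕ) :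
    HasPowerSum (P ^ p) x (v ^ p) := by
  induction p with
  | zero =>
    rw [pow_zero, pow_zero]
    unfold HasPowerSum
    convert! hasSum_single (f := fun n => PowerSeries.coeff n (1 : PowerSeries ℂ) * x ^ n) 0 ?_
    · simp
    · intro n hn
      simp [PowerSeries.coeff_one, hn]
  | succ p ih =>
    rw [pow_succ, pow_succ]
    exact ih.mul hP

/-- The pointwise form of `mobOp`. -/
def mobVal (r x : ℂ) : ℂ := if ‖r‖ = 1 then r else (x + r) / (1 + star r * x)

theorem mul_star_self_eq_norm_sq (r : ℂ) : r * star r = ((‖r‖ ^ 2 : ℝ) : ℂ) := by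
  rw [Complex.ofReal_pow]
  exact Complex.mul_conj' r

theorem one_add_star_mul_ne_zero {r x : ℂ} (h : ‖r‖ * ‖x‖ < 1) : 1 + star r * x ≠ 0 := by
  intro h0
  have h1 : ‖star r * x‖ = 1 := by
    rw [show star r * x = -1 by linear_combination h0]; simp
  rw [norm_mul, norm_star] at h1
  linarith

/-- A geometric series. If `|r| = 1`, the factor `1 - r r̄` kills all terms after the first, in
agreement with the convention for the constant `r`. -/
theorem hasPowerSum_mobSeries {r x : ℂ} (hr : ‖r‖ ≤ 1) (hx : ‖x‖ < 1) :
    HasPowerSum (mobSeries r) x (mobVal r x) := by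
  have hrx : ‖r‖ * ‖x‖ < 1 := by nlinarith [norm_nonneg r, norm_nonneg x]
  have hlt : ‖-star r * x‖ < 1 := by rwa [norm_mul, norm_neg, norm_star]
  have hgeo : HasSum (fun n : ℕ => (1 - r * star r) * x * (-star r * x) ^ n)
      ((1 - r * star r) * x * (1 - -star r * x)⁻¹) :=
    (hasSum_geometric_of_norm_lt_one hlt).mul_left ((1 - r * star r) * x)
  have hne := one_add_star_mul_ne_zero hrx
  have hval : (1 - r * star r) * x * (1 - -star r * x)⁻¹ + r = mobVal r x := by
    rw [show 1 - -star r * x = 1 + star r * x by ring, mobVal]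
    split_ifs with h1
    · rw [mul_star_self_eq_norm_sq, h1]; simp
    · field_simp
      ring
  unfold HasPowerSum
  rw [← hval]
  have h := (hasSum_nat_add_iff (f := fun n => PowerSeries.coeff n (mobSeries r) * x ^ n)
    (g := (1 - r * star r) * x * (1 - -star r * x)⁻¹) 1).mp
  have h0 : ∑ i ∈ Finset.range 1, PowerSeries.coeff i (mobSeries r) * x ^ i = r := by
    simp [mobSeries]
  rw [h0] at h
  refine h (hgeo.congr_fun fun n => ?_)
  rw [mobSeries, PowerSeries.coeff_mk, if_neg (Nat.succ_ne_zero n), Nat.add_sub_cancel, mul_pow,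
    pow_succ]
  ring

theorem hasSum_scatteringPoly {r x : ℂ} (hr : ‖r‖ ≤ 1) (hx : ‖x‖ < 1) (p : ℕ) :
    HasSum (fun q => scatteringPoly p q r * x ^ q) (mobVal r x ^ p) := by
  have h := (hasPowerSum_mobSeries hr hx).pow p
  simpa only [HasPowerSum, coeff_mobSeries_pow] using h

/-! ### Cauchy's estimate on the polydisk -/

section CauchyEstimate

open MeasureTheory AddCircle

theorem integral_fourier_haarAddCircle (n : ℤ) :
    ∫ x : AddCircle (1 : ℝ), fourier n x ∂haarAddCircle = if n = 0 then 1 else 0 := by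
  split_ifs with h
  · simp [h]
  · exact integral_eq_zero_of_add_right_eq_neg (μ := haarAddCircle)
      (fourier_add_half_inv_index h one_pos)

theorem norm_fourier_apply (n : ℤ) (x : AddCircle (1 : ℝ)) : ‖fourier n x‖ = 1 := by
  rw [fourier_apply]
  exact Circle.norm_coe _

theorem fourier_natCast_apply (n : ℕ) (x : AddCircle (1 : ℝ)) :
    fourier (n : ℤ) x = fourier 1 x ^ n := by
  rw [fourier_apply, fourier_apply, natCast_zsmul, one_zsmul, toCircle_nsmul, Circle.coe_pow]

theorem norm_le_one_of_mul_pow_le_one {x : ℝ} {m : ℕ}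
    (h : ∀ ρ : ℝ, 0 < ρ → ρ < 1 → x * ρ ^ m ≤ 1) : x ≤ 1 := by
  have hlim : Tendsto (fun ρ : ℝ => x * ρ ^ m) (𝓝[<] 1) (𝓝 (x * 1 ^ m)) :=
    ((continuous_const.mul (continuous_pow m)).tendsto 1).mono_left nhdsWithin_le_nhds
  rw [one_pow, mul_one] at hlim
  refine le_of_tendsto hlim ?_
  filter_upwards [Ioo_mem_nhdsLT (show (0 : ℝ) < 1 by norm_num)] with ρ hρ
  exact h ρ hρ.1 hρ.2

variable {ι : Type*} [Fintype ι]

/-- The Taylor coefficients of a function which is bounded by `1` on the polydisk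
are bounded by `1`. -/
theorem norm_coeff_le_one {a : (ι → ℕ) → ℂ} {F : (ι → ℂ) → ℂ}
    (h : ∀ z : ι → ℂ, (∀ i, ‖z i‖ < 1) → HasSum (fun γ => a γ * ∏ i, z i ^ γ i) (F z))
    (hF : ∀ z : ι → ℂ, (∀ i, ‖z i‖ < 1) → ‖F z‖ ≤ 1) (β : ι → ℕ) : ‖a β‖ ≤ 1 := by
  refine norm_le_one_of_mul_pow_le_one (m := ∑ i, β i) fun ρ hρ0 hρ1 => ?_
  let μ : Measure (ι → AddCircle (1 : ℝ)) := Measure.pi fun _ => haarAddCircle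
  -- The `γ`-term on the torus of radius `ρ`, times the character of frequency `-β`: integration
  -- over the torus isolates `γ = β`.
  let G : (ι → ℕ) → (ι → AddCircle (1 : ℝ)) → ℂ := fun γ x =>
    (a γ * ∏ i, (ρ : ℂ) ^ γ i) * ∏ i, fourier ((γ i : ℤ) - β i) (x i)
  have hGnorm : ∀ γ x, ‖G γ x‖ = ‖a γ * ∏ i, (ρ : ℂ) ^ γ i‖ := fun γ x => by
    simp only [G]
    rw [norm_mul, norm_prod (s := Finset.univ) (f := fun i => fourier ((γ i : ℤ) - β i) (x i))]
    simp only [norm_fourier_apply, Finset.prod_const_one, mul_one]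
  have hρ : ∀ i : ι, ‖(ρ : ℂ)‖ < 1 := fun _ => by
    rwa [Complex.norm_real, Real.norm_of_nonneg hρ0.le]
  have hsum := (h (fun _ => (ρ : ℂ)) hρ).summable.norm
  have hcont : ∀ γ, Continuous (G γ) := fun γ => by
    simp only [G]
    fun_prop
  have hint : ∀ γ, Integrable (G γ) μ := fun γ =>
    Integrable.of_bound (hcont γ).aestronglyMeasurable _ (.of_forall fun x => (hGnorm γ x).le)
  have hval : ∀ γ, ∫ x, G γ x ∂μ = if γ = β then a β * ∏ i, (ρ : ℂ) ^ β i else 0 := fun γ => by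
    simp only [G, μ]
    rw [integral_const_mul, integral_fintype_prod_eq_prod
      (f := fun i x => fourier ((γ i : ℤ) - β i) x)]
    simp only [integral_fourier_haarAddCircle]
    split_ifs with hγ
    · simp [hγ]
    · obtain ⟨i, hi⟩ := Function.ne_iff.mp hγ
      refine mul_eq_zero_of_right _ (Finset.prod_eq_zero (Finset.mem_univ i) (if_neg ?_))
      omega
  have hHS := hasSum_integral_of_summable_integral_norm hint (by
    simpa only [hGnorm, integral_const, probReal_univ, one_smul] using hsum)
  have heq : a β * ∏ i, (ρ : ℂ) ^ β i = ∫ x, ∑' γ, G γ x ∂μ := by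
    refine HasSum.unique ?_ hHS
    simp only [hval]
    exact hasSum_ite_eq β _
  have hbound : ∀ x, ‖∑' γ, G γ x‖ ≤ 1 := fun x => by
    have hz : ∀ i, ‖(ρ : ℂ) * fourier 1 (x i)‖ < 1 := fun i => by
      rw [norm_mul, fourier_apply, Circle.norm_coe, mul_one]
      exact hρ i
    have h1 := (h _ hz).mul_left (∏ i, fourier (-(β i : ℤ)) (x i))
    have h2 : (fun γ => (∏ i, fourier (-(β i : ℤ)) (x i)) *
        (a γ * ∏ i, ((ρ : ℂ) * fourier 1 (x i)) ^ γ i)) = fun γ => G γ x := by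
      funext γ
      simp only [G]
      have h3 : ∀ i, fourier ((γ i : ℤ) - β i) (x i) =
          fourier (-(β i : ℤ)) (x i) * fourier 1 (x i) ^ γ i := fun i => by
        rw [sub_eq_add_neg, fourier_add, mul_comm, fourier_natCast_apply]
      simp only [h3, mul_pow, Finset.prod_mul_distrib]
      ring
    rw [h2] at h1
    rw [h1.tsum_eq, norm_mul, norm_prod]
    simp only [norm_fourier_apply, Finset.prod_const_one, one_mul]
    exact hF _ hz
  have hle := norm_integral_le_of_norm_le_const (μ := μ) (.of_forall hbound)
  rw [← heq, probReal_univ, one_mul, norm_mul, Finset.prod_pow_eq_pow_sum, norm_pow,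
    Complex.norm_real, Real.norm_of_nonneg hρ0.le] at hle
  exact hle

end CauchyEstimate

/-! ### Möbius maps of the disk and the bound on scattering polynomials -/

theorem norm_add_le_norm_one_add_star_mul {r x : ℂ} (hr : ‖r‖ ≤ 1) (hx : ‖x‖ ≤ 1) :
    ‖x + r‖ ≤ ‖1 + star r * x‖ := by
  have h1 : ‖x + r‖ ^ 2 = ‖x‖ ^ 2 + ‖r‖ ^ 2 + 2 * (star r * x).re := by
    rw [Complex.sq_norm, Complex.normSq_add, Complex.sq_norm, Complex.sq_norm]
    simp only [Complex.star_def, mul_comm]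
  have h2 : ‖1 + star r * x‖ ^ 2 = 1 + ‖r‖ ^ 2 * ‖x‖ ^ 2 + 2 * (star r * x).re := by
    rw [Complex.sq_norm, Complex.normSq_add, ← Complex.sq_norm, ← Complex.sq_norm, norm_mul,
      norm_star]
    simp
    ring
  refine le_of_sq_le_sq ?_ (norm_nonneg _)
  -- The difference of the squares is `(1 - |r|²)(1 - |x|²)`.
  nlinarith [mul_nonneg (sub_nonneg.mpr (pow_le_one₀ (n := 2) (norm_nonneg r) hr))
    (sub_nonneg.mpr (pow_le_one₀ (n := 2) (norm_nonneg x) hx))]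

theorem norm_mobVal_le_one {r x : ℂ} (hr : ‖r‖ ≤ 1) (hx : ‖x‖ ≤ 1) : ‖mobVal r x‖ ≤ 1 := by
  rw [mobVal]
  split_ifs with h
  · exact hr
  · rw [norm_div]
    exact div_le_one_of_le₀ (norm_add_le_norm_one_add_star_mul hr hx) (norm_nonneg _)

theorem norm_scatteringPoly_le_one {r : ℂ} (hr : ‖r‖ ≤ 1) (p q : ℕ) :
    ‖scatteringPoly p q r‖ ≤ 1 := by
  refine norm_coeff_le_one (ι := Unit) (a := fun γ => scatteringPoly p (γ ()) r)
    (F := fun z => mobVal r (z ()) ^ p) (fun z hz => ?_) (fun z hz => ?_) (fun _ => q)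
  · rw [← (Equiv.funUnique Unit ℕ).symm.hasSum_iff]
    simpa [Function.comp_def] using hasSum_scatteringPoly hr (hz ()) p
  · rw [norm_pow]
    exact pow_le_one₀ (norm_nonneg _) (norm_mobVal_le_one hr (hz ()).le)

/-! ### Summation of monomials -/

theorem summable_prod_pow {n : ℕ} {x : Fin n → ℝ} (h0 : ∀ i, 0 ≤ x i) (h1 : ∀ i, x i < 1) :
    Summable fun γ : Fin n → ℕ => ∏ i, x i ^ γ i := by
  induction n with
  | zero => exact Summable.of_finite
  | succ n ih =>
    rw [← (Fin.consEquiv fun _ : Fin (n + 1) => ℕ).summable_iff]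
    have hs := (summable_geometric_of_lt_one (h0 0) (h1 0)).mul_of_nonneg
      (ih (fun i => h0 i.succ) (fun i => h1 i.succ)) (fun _ => pow_nonneg (h0 0) _)
      (fun γ => Finset.prod_nonneg fun i _ => pow_nonneg (h0 i.succ) _)
    refine hs.congr fun γ => ?_
    simp [Fin.consEquiv, Fin.prod_univ_succ]

theorem polydisk_eq_ball (d : ℕ) : polydisk d = Metric.ball 0 1 := by
  ext z
  rw [mem_ball_zero_iff, pi_norm_lt_iff one_pos]
  rfl

theorem exists_subset_closedBall {d : ℕ} {K : Set (Fin d → ℂ)} (hK : K ⊆ polydisk d)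
    (hc : IsCompact K) : ∃ ρ : ℝ, 1 / 2 ≤ ρ ∧ ρ < 1 ∧ ∀ z ∈ K, ‖z‖ ≤ ρ := by
  rw [polydisk_eq_ball] at hK
  obtain ⟨ρ, hρ, hKρ⟩ := exists_lt_subset_ball hc.isClosed hK
  refine ⟨max ρ (1 / 2), le_max_right _ _, max_lt hρ (by norm_num), fun z hz => ?_⟩
  exact (mem_ball_zero_iff.mp (hKρ hz)).le.trans (le_max_left _ _)

/-! ### Convergents -/

/-- The definition adds layers on the inside; the inductions below peel off the outermost one and
shift the sequences. -/
theorem convergentOp_succ' {d : ℕ} (r : ℕ → ℂ) (ν : ℕ → Fin d) (n : ℕ)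
    (h : (Fin d → ℂ) → ℂ) :
    convergentOp r ν (n + 1) h = mobOp (r 0) (mulOp (ν 0)
      (convergentOp (fun i => r (i + 1)) (fun i => ν (i + 1)) n h)) := by
  induction n generalizing h with
  | zero => rfl
  | succ n ih =>
    rw [convergentOp, ih]
    rfl

theorem convergent_zero {d : ℕ} (r : ℕ → ℂ) (ν : ℕ → Fin d) (z : Fin d → ℂ) :
    convergent r ν 0 z = mobVal (r 0) 0 := rfl

theorem convergent_succ {d : ℕ} (r : ℕ → ℂ) (ν : ℕ → Fin d) (n : ℕ) (z : Fin d → ℂ) :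
    convergent r ν (n + 1) z = mobVal (r 0) (z (ν 0) *
      convergent (fun i => r (i + 1)) (fun i => ν (i + 1)) n z) := by
  rw [convergent, convergentOp_succ']
  rfl

theorem mobVal_zero (r : ℂ) : mobVal r 0 = r := by
  simp [mobVal]

theorem norm_convergent_le_one {d : ℕ} {r : ℕ → ℂ} (hr : ∀ n, ‖r n‖ ≤ 1) (ν : ℕ → Fin d)
    (n : ℕ) {z : Fin d → ℂ} (hz : z ∈ polydisk d) : ‖convergent r ν n z‖ ≤ 1 := by
  induction n generalizing r ν with
  | zero =>
    rw [convergent_zero, mobVal_zero]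
    exact hr 0
  | succ n ih =>
    rw [convergent_succ]
    refine norm_mobVal_le_one (hr 0) ?_
    rw [norm_mul]
    exact mul_le_one₀ (hz _).le (norm_nonneg _) (ih (fun i => hr (i + 1)) _)

/-! ### Expansion of convergents -/

/-- The scattering weight of a multi-index of length `n`, with initial exponent `p`. -/
def chainWeight (r : ℕ → ℂ) : (n : ℕ) → ℕ → (Fin n → ℕ) → ℂ
  | 0, p, _ => scatteringPoly p 0 (r 0)
  | n + 1, p, γ => scatteringPoly p (γ 0) (r 0) *
      chainWeight (fun i => r (i + 1)) n (γ 0) (Fin.tail γ)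

theorem norm_chainWeight_le_one {r : ℕ → ℂ} (hr : ∀ n, ‖r n‖ ≤ 1) (n p : ℕ) (γ : Fin n → ℕ) :
    ‖chainWeight r n p γ‖ ≤ 1 := by
  induction n generalizing r p with
  | zero => exact norm_scatteringPoly_le_one (hr 0) p 0
  | succ n ih =>
    rw [chainWeight, norm_mul]
    exact mul_le_one₀ (norm_scatteringPoly_le_one (hr 0) _ _) (norm_nonneg _)
      (ih (fun i => hr (i + 1)) _ _)

theorem norm_chainWeight_mul_prod_le {r : ℕ → ℂ} (hr : ∀ n, ‖r n‖ ≤ 1) (n p : ℕ)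
    (γ : Fin n → ℕ) (w : Fin n → ℂ) :
    ‖chainWeight r n p γ * ∏ i, w i ^ γ i‖ ≤ ∏ i, ‖w i‖ ^ γ i := by
  rw [norm_mul, norm_prod]
  simp only [norm_pow]
  exact mul_le_of_le_one_left (Finset.prod_nonneg fun i _ => by positivity)
    (norm_chainWeight_le_one hr n p γ)

/-- A general exponent `p` is needed because the induction meets every power `w^q` of the inner
convergent. Absolute summability is established first, so summing over the tail of `γ` before its
head determines the total. -/
theorem hasSum_chainWeight {d : ℕ} {r : ℕ → ℂ} (hr : ∀ n, ‖r n‖ ≤ 1) (ν : ℕ → Fin d) (n p : ℕ)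
    {z : Fin d → ℂ} (hz : z ∈ polydisk d) :
    HasSum (fun γ : Fin n → ℕ => chainWeight r n p γ * ∏ i : Fin n, z (ν i) ^ γ i)
      (convergent r ν n z ^ p) := by
  induction n generalizing r ν p with
  | zero =>
    rw [convergent_zero, mobVal_zero]
    convert! hasSum_unique fun γ : Fin 0 → ℕ =>
      chainWeight r 0 p γ * ∏ i : Fin 0, z (ν i) ^ γ i using 1
    simp [chainWeight, scatteringPoly_zero_right]
  | succ n ih =>
    have hr' : ∀ i, ‖r (i + 1)‖ ≤ 1 := fun i => hr (i + 1)
    set f : (Fin (n + 1) → ℕ) → ℂ := fun γ =>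
      chainWeight r (n + 1) p γ * ∏ i : Fin (n + 1), z (ν i) ^ γ i
    have hsum : Summable f := Summable.of_norm_bounded
      (summable_prod_pow (fun _ => norm_nonneg _) (fun i : Fin (n + 1) => hz (ν i)))
      fun γ => norm_chainWeight_mul_prod_le hr (n + 1) p γ fun i => z (ν i)
    have htot := ((Fin.consEquiv fun _ : Fin (n + 1) => ℕ).hasSum_iff).mpr hsum.hasSum
    set w := convergent (fun i => r (i + 1)) (fun i => ν (i + 1)) n z
    have hw : ‖z (ν 0) * w‖ < 1 := by
      rw [norm_mul]
      exact (mul_le_of_le_one_right (norm_nonneg _)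
        (norm_convergent_le_one hr' _ n hz)).trans_lt (hz _)
    have hinner : ∀ q : ℕ, HasSum
        (fun γ : Fin n → ℕ => (f ∘ Fin.consEquiv fun _ : Fin (n + 1) => ℕ) (q, γ))
        (scatteringPoly p q (r 0) * (z (ν 0) * w) ^ q) := fun q => by
      have h := (ih hr' (fun i => ν (i + 1)) q).mul_left
        (scatteringPoly p q (r 0) * z (ν 0) ^ q)
      rw [mul_assoc, ← mul_pow] at h
      refine h.congr_fun fun γ => ?_
      simp only [f, Function.comp_apply, Fin.consEquiv, Equiv.coe_fn_mk, chainWeight,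
        Fin.prod_univ_succ, Fin.cons_zero, Fin.cons_succ, Fin.tail_cons, Fin.val_zero,
        Fin.val_succ]
      ring
    have h1 := htot.prod_fiberwise hinner
    have h2 := hasSum_scatteringPoly (hr 0) hw p
    rw [convergent_succ, h2.unique h1]
    exact hsum.hasSum

theorem chainWeight_eq_prod (r : ℕ → ℂ) (n p : ℕ) {α : ℕ → ℕ} (hα : ∀ i, n ≤ i → α i = 0) :
    chainWeight r n p (fun i => α i) = scatteringPoly p (α 0) (r 0) *
      ∏ i ∈ Finset.range n, scatteringPoly (α i) (α (i + 1)) (r (i + 1)) := by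
  induction n generalizing r p α with
  | zero => simp [chainWeight, hα 0 le_rfl]
  | succ n ih =>
    have h := ih (fun i => r (i + 1)) (α 0) (α := fun i => α (i + 1))
      fun i hi => hα _ (Nat.succ_le_succ hi)
    rw [Finset.prod_range_succ', mul_comm (∏ _ ∈ _, _), ← h]
    rfl

/-- The two products differ only in factors beyond the support, which are `φ^{(0,0)} = 1`. -/
theorem scatteringWeight_eq_chainWeight (r : ℕ → ℂ) {n : ℕ} {α : ℕ →₀ ℕ} (hα : α ∈ indexSet n) :
    scatteringWeight α r = chainWeight r n 1 fun i => α i := by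
  rw [chainWeight_eq_prod r n 1 hα, scatteringWeight]
  congr 1
  have hsup : ∀ i, (α.support.sup fun i => i + 1) ≤ i → α i = 0 := fun i hi => by
    by_contra h0
    have := Finset.le_sup (f := fun i : ℕ => i + 1) (Finsupp.mem_support_iff.mpr h0)
    omega
  refine Finset.prod_subset (fun i hi => ?_) fun i _ hi => ?_
  · rw [Finset.mem_range] at hi ⊢
    refine hi.trans_le (Finset.sup_le fun j hj => ?_)
    by_contra h0
    exact Finsupp.mem_support_iff.mp hj (hα j (by omega))
  · rw [Finset.mem_range, not_lt] at hi
    rw [hsup i hi, hsup (i + 1) (by omega), scatteringPoly_zero_right, pow_zero]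

theorem allocMonomial_eq_prod {d : ℕ} (ν : ℕ → Fin d) {n : ℕ} {α : ℕ →₀ ℕ}
    (hα : α ∈ indexSet n) (z : Fin d → ℂ) :
    allocMonomial ν α z = ∏ i : Fin n, z (ν i) ^ α i := by
  rw [allocMonomial, Finsupp.prod_of_support_subset α (s := Finset.range n) ?_ _ (by simp),
    ← Fin.prod_univ_eq_prod_range fun i => z (ν i) ^ α i]
  intro i hi
  rw [Finset.mem_range]
  by_contra h0
  exact Finsupp.mem_support_iff.mp hi (hα i (by omega))

/-- Multi-indices supported in the first `n` places are tuples of length `n`. -/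
def indexSetEquiv (n : ℕ) : indexSet n ≃ (Fin n → ℕ) where
  toFun α i := α.1 i
  invFun γ := ⟨Finsupp.onFinset (Finset.range n) (fun i => if h : i < n then γ ⟨i, h⟩ else 0)
    (fun i hi => by
      rw [Finset.mem_range]
      by_contra h
      exact hi (dif_neg h)), fun i hi => by
      rw [Finsupp.onFinset_apply, dif_neg (by omega)]⟩
  left_inv α := by
    ext i
    by_cases h : i < n
    · simp [h]
    · simp [h, α.2 i (by omega)]
  right_inv γ := by
    ext i
    simp

theorem hasSum_indexSet {d : ℕ} {r : ℕ → ℂ} (hr : ∀ n, ‖r n‖ ≤ 1) (ν : ℕ → Fin d) (n : ℕ)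
    {z : Fin d → ℂ} (hz : z ∈ polydisk d) :
    HasSum (fun α : indexSet n => scatteringWeight α r * allocMonomial ν α z)
      (convergent r ν n z) := by
  have h := hasSum_chainWeight hr ν n 1 hz
  rw [← (indexSetEquiv n).hasSum_iff, pow_one] at h
  refine h.congr_fun fun α => ?_
  rw [scatteringWeight_eq_chainWeight r α.2, allocMonomial_eq_prod ν α.2]
  rfl

theorem hasSumUniformlyOn_indexSet {d : ℕ} {r : ℕ → ℂ} (hr : ∀ n, ‖r n‖ ≤ 1) (ν : ℕ → Fin d)
    (n : ℕ) {K : Set (Fin d → ℂ)} (hK : K ⊆ polydisk d) (hc : IsCompact K) :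
    HasSumUniformlyOn
      (fun (α : indexSet n) (z : Fin d → ℂ) => scatteringWeight α r * allocMonomial ν α z)
      (convergent r ν n) K := by
  obtain ⟨ρ, hρ0, hρ1, hρ⟩ := exists_subset_closedBall hK hc
  have hs : Summable fun α : indexSet n => ∏ i : Fin n, ρ ^ α.1 i := by
    have h := summable_prod_pow (x := fun _ : Fin n => ρ) (fun _ => by linarith) fun _ => hρ1
    rw [← (indexSetEquiv n).summable_iff] at h
    exact h
  refine (HasSumUniformlyOn.of_norm_le_summable hs fun α z hz => ?_).congr_right fun z hz =>
    (hasSum_indexSet hr ν n (hK hz)).tsum_eq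
  rw [scatteringWeight_eq_chainWeight r α.2, allocMonomial_eq_prod ν α.2]
  refine (norm_chainWeight_mul_prod_le hr n 1 _ _).trans (Finset.prod_le_prod
    (fun i _ => by positivity) fun i _ => pow_le_pow_left₀ (norm_nonneg _) ?_ _)
  exact (norm_le_pi_norm z _).trans (hρ z hz)

/-! ### Convergence of the convergents -/

/-- After squaring, the difference is affine in `Re u` with slope `2(1 - t²)² ≥ 0`, so the worst
case is `Re u = -|u|`, where it factors into the nonnegative products `ht` and `hx`. -/
theorem norm_one_sub_le_of_norm_le_one {u : ℂ} (hu : ‖u‖ ≤ 1) {t : ℝ} (h0 : 0 ≤ t) (h1 : t ≤ 1) :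
    (1 + t ^ 2) * ‖1 - u‖ ≤ 2 * ‖1 - (t : ℂ) ^ 2 * u‖ := by
  refine le_of_sq_le_sq ?_ (by positivity)
  have hre : -‖u‖ ≤ u.re := (abs_le.mp (Complex.abs_re_le_norm u)).1
  have e1 : ‖1 - u‖ ^ 2 = 1 + ‖u‖ ^ 2 - 2 * u.re := by
    simp only [Complex.sq_norm, Complex.normSq_apply, Complex.sub_re, Complex.sub_im,
      Complex.one_re, Complex.one_im]
    ring
  have e2 : ‖1 - (t : ℂ) ^ 2 * u‖ ^ 2 = 1 + t ^ 4 * ‖u‖ ^ 2 - 2 * t ^ 2 * u.re := by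
    rw [← Complex.ofReal_pow]
    simp only [Complex.sq_norm, Complex.normSq_apply, Complex.sub_re, Complex.sub_im,
      Complex.one_re, Complex.one_im, Complex.re_ofReal_mul, Complex.im_ofReal_mul]
    ring
  rw [mul_pow, mul_pow, e1, e2]
  have ht : 0 ≤ 1 - t ^ 2 := sub_nonneg.mpr (pow_le_one₀ h0 h1)
  have hx : 0 ≤ (1 - ‖u‖) * (3 + t ^ 2 + ‖u‖ * (1 + 3 * t ^ 2)) :=
    mul_nonneg (by linarith) (by positivity)
  have hy : 0 ≤ (1 - t ^ 2) * (u.re + ‖u‖) := mul_nonneg ht (by linarith)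
  nlinarith [mul_nonneg ht hx, mul_nonneg ht hy]

/-- A bound for the pseudo-hyperbolic distance, in a form which makes sense on the boundary. -/
def PseudoDistLE (c : ℝ) (a b : ℂ) : Prop := ‖a - b‖ ≤ c * ‖1 - star a * b‖

theorem pseudoDistLE_one {a b : ℂ} (ha : ‖a‖ ≤ 1) (hb : ‖b‖ ≤ 1) : PseudoDistLE 1 a b := by
  have h := norm_add_le_norm_one_add_star_mul (r := -a) (x := b) (by rwa [norm_neg]) hb
  rw [PseudoDistLE, one_mul, norm_sub_rev]
  rwa [star_neg, neg_mul, ← sub_eq_add_neg, ← sub_eq_add_neg] at h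

/-- The source of contraction. The factor does not depend on `a` and `b`, which may lie on the unit
circle. -/
theorem PseudoDistLE.mul_left {c s : ℝ} {a b ξ : ℂ} (h : PseudoDistLE c a b) (hc : 0 ≤ c)
    (ha : ‖a‖ ≤ 1) (hb : ‖b‖ ≤ 1) (hξ : ‖ξ‖ ≤ s) (hs : s < 1) :
    PseudoDistLE (2 * s / (1 + s ^ 2) * c) (ξ * a) (ξ * b) := by
  set t := ‖ξ‖
  have ht0 : 0 ≤ t := norm_nonneg ξ
  have hu : ‖star a * b‖ ≤ 1 := by
    rw [norm_mul, norm_star]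
    exact mul_le_one₀ ha (norm_nonneg _) hb
  have h1 := norm_one_sub_le_of_norm_le_one hu ht0 (hξ.trans hs.le)
  have h2 : star (ξ * a) * (ξ * b) = (t : ℂ) ^ 2 * (star a * b) := by
    rw [star_mul', ← Complex.ofReal_pow, ← mul_star_self_eq_norm_sq]
    ring
  -- Monotonicity of `t / (1 + t²)` on `[0, 1]`.
  have h3 : t ≤ s / (1 + s ^ 2) * (1 + t ^ 2) := by
    rw [div_mul_eq_mul_div, le_div_iff₀ (by positivity)]
    nlinarith [mul_nonneg (sub_nonneg.mpr hξ) (show 0 ≤ 1 - t * s by nlinarith)]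
  have hs0 : 0 ≤ s / (1 + s ^ 2) := div_nonneg (ht0.trans hξ) (by positivity)
  rw [PseudoDistLE, ← mul_sub, norm_mul, h2]
  calc t * ‖a - b‖ ≤ t * (c * ‖1 - star a * b‖) := mul_le_mul_of_nonneg_left h ht0
    _ ≤ s / (1 + s ^ 2) * (1 + t ^ 2) * (c * ‖1 - star a * b‖) :=
        mul_le_mul_of_nonneg_right h3 (by positivity)
    _ = s / (1 + s ^ 2) * c * ((1 + t ^ 2) * ‖1 - star a * b‖) := by ring
    _ ≤ s / (1 + s ^ 2) * c * (2 * ‖1 - (t : ℂ) ^ 2 * (star a * b)‖) :=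
        mul_le_mul_of_nonneg_left h1 (by positivity)
    _ = _ := by ring

/-- For `|r| < 1` both sides of the bound acquire the same factor `1 - r r̄` and denominators of
equal modulus; for `|r| = 1` the two images coincide. -/
theorem PseudoDistLE.mobVal {c : ℝ} {a b r : ℂ} (h : PseudoDistLE c a b) (hc : 0 ≤ c)
    (ha : ‖a‖ < 1) (hb : ‖b‖ < 1) (hr : ‖r‖ ≤ 1) :
    PseudoDistLE c (mobVal r a) (mobVal r b) := by
  unfold PseudoDistLE _root_.mobVal
  split_ifs with h1
  · rw [sub_self, norm_zero]
    positivity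
  have ha' : 1 + star r * a ≠ 0 :=
    one_add_star_mul_ne_zero (by nlinarith [norm_nonneg r, norm_nonneg a])
  have hb' : 1 + star r * b ≠ 0 :=
    one_add_star_mul_ne_zero (by nlinarith [norm_nonneg r, norm_nonneg b])
  have ha'' : 1 + r * star a ≠ 0 := by
    intro h0
    apply ha'
    have := congrArg star h0
    simpa [mul_comm] using this
  have hn : ‖1 + r * star a‖ = ‖1 + star r * a‖ := by
    rw [← norm_star]
    simp
  have e1 : (a + r) / (1 + star r * a) - (b + r) / (1 + star r * b) =
      (1 - r * star r) * (a - b) / ((1 + star r * a) * (1 + star r * b)) := by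
    rw [div_sub_div _ _ ha' hb']
    congr 1
    ring
  have e2 : 1 - star ((a + r) / (1 + star r * a)) * ((b + r) / (1 + star r * b)) =
      (1 - r * star r) * (1 - star a * b) / ((1 + r * star a) * (1 + star r * b)) := by
    rw [star_div₀, star_add, star_add, star_mul', star_star, star_one,
      div_mul_div_comm, eq_div_iff (mul_ne_zero ha'' hb'), sub_mul, one_mul,
      div_mul_cancel₀ _ (mul_ne_zero ha'' hb')]
    ring
  rw [e1, e2, norm_div, norm_div, norm_mul, norm_mul, norm_mul, norm_mul, hn, ← mul_div_assoc]
  refine div_le_div_of_nonneg_right ?_ (by positivity)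
  rw [mul_left_comm]
  exact mul_le_mul_of_nonneg_left h (norm_nonneg _)

theorem pseudoDistLE_convergent {d : ℕ} {r : ℕ → ℂ} (hr : ∀ n, ‖r n‖ ≤ 1) {ν : ℕ → Fin d}
    {z : Fin d → ℂ} {s : ℝ} (hs : s < 1) (hz : ‖z‖ ≤ s) {x : ℕ → ℂ} (hx : ∀ n, ‖x n‖ ≤ 1)
    (hstep : ∀ n, x n = mobVal (r n) (z (ν n) * x (n + 1))) (n : ℕ) :
    PseudoDistLE ((2 * s / (1 + s ^ 2)) ^ n) (x 0) (convergent r ν n z) := by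
  have hzp : z ∈ polydisk d := fun i => ((norm_le_pi_norm z i).trans hz).trans_lt hs
  induction n generalizing r ν x with
  | zero =>
    rw [pow_zero]
    exact pseudoDistLE_one (hx 0) (norm_convergent_le_one hr ν 0 hzp)
  | succ n ih =>
    have hk : 0 ≤ 2 * s / (1 + s ^ 2) :=
      div_nonneg (by linarith [(norm_nonneg z).trans hz]) (by positivity)
    have hlt : ∀ y : ℂ, ‖y‖ ≤ 1 → ‖z (ν 0) * y‖ < 1 := fun y hy => by
      rw [norm_mul]
      exact (mul_le_of_le_one_right (norm_nonneg _) hy).trans_lt (hzp _)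
    have hr' : ∀ i, ‖r (i + 1)‖ ≤ 1 := fun i => hr (i + 1)
    have hconv := norm_convergent_le_one hr' (fun i => ν (i + 1)) n hzp
    rw [convergent_succ, hstep 0, pow_succ']
    exact ((ih hr' (fun i => hx (i + 1)) fun i => hstep (i + 1)).mul_left (pow_nonneg hk n)
      (hx 1) hconv ((norm_le_pi_norm z _).trans hz) hs).mobVal (by positivity)
      (hlt _ (hx 1)) (hlt _ hconv) (hr 0)

theorem zero_mem_polydisk (d : ℕ) : (0 : Fin d → ℂ) ∈ polydisk d := fun _ => by simp

theorem IsContinuedFraction.norm_param_le_one {d : ℕ} [NeZero d] {f : (Fin d → ℂ) → ℂ}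
    {r : ℕ → ℂ} {ν : ℕ → Fin d} {h : ℕ → (Fin d → ℂ) → ℂ} (hf : IsContinuedFraction f r ν h)
    (n : ℕ) : ‖r n‖ ≤ 1 := by
  rw [hf.param n]
  exact (hf.schur n).1.2 _ (zero_mem_polydisk d)

theorem IsContinuedFraction.tendstoUniformlyOn {d : ℕ} [NeZero d] {f : (Fin d → ℂ) → ℂ}
    {r : ℕ → ℂ} {ν : ℕ → Fin d} {h : ℕ → (Fin d → ℂ) → ℂ} (hf : IsContinuedFraction f r ν h)
    {K : Set (Fin d → ℂ)} (hK : K ⊆ polydisk d) (hc : IsCompact K) :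
    TendstoUniformlyOn (fun n => convergent r ν n) f atTop K := by
  obtain ⟨s, hs0, hs1, hs⟩ := exists_subset_closedBall hK hc
  set k := 2 * s / (1 + s ^ 2)
  have hk0 : 0 ≤ k := div_nonneg (by linarith) (by positivity)
  have hk1 : k < 1 := by
    rw [div_lt_one (by positivity)]
    nlinarith [mul_pos (sub_pos.mpr hs1) (sub_pos.mpr hs1)]
  have hlim : Tendsto (fun n => k ^ n * 2) atTop (𝓝 0) := by
    simpa using (tendsto_pow_atTop_nhds_zero_of_lt_one hk0 hk1).mul_const 2
  rw [Metric.tendstoUniformlyOn_iff]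
  intro ε hε
  filter_upwards [hlim.eventually (gt_mem_nhds hε)] with n hn z hz
  have hx : ∀ n, ‖h n z‖ ≤ 1 := fun n => (hf.schur n).1.2 z (hK hz)
  have hd := pseudoDistLE_convergent (x := fun n => h n z) hf.norm_param_le_one hs1 (hs z hz) hx
    (fun n => hf.step n (hK hz)) n
  simp only [hf.start] at hd
  rw [dist_eq_norm]
  refine (hd.trans ?_).trans_lt hn
  -- The weight `|1 - āb|` is at most 2, so the pseudo-hyperbolic bound gives a Euclidean one.
  refine mul_le_mul_of_nonneg_left ?_ (pow_nonneg hk0 n)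
  refine (norm_sub_le _ _).trans ?_
  rw [norm_one, norm_mul, norm_star]
  have h0 := hx 0
  rw [hf.start] at h0
  linarith [mul_le_one₀ h0 (norm_nonneg _)
    (norm_convergent_le_one hf.norm_param_le_one ν n (hK hz))]

/-! ### The Taylor series -/

theorem allocMonomial_eq_of_mapDomain_eq {d : ℕ} {ν : ℕ → Fin d} {α : ℕ →₀ ℕ} {β : Fin d →₀ ℕ}
    (h : α.mapDomain ν = β) (z : Fin d → ℂ) : allocMonomial ν α z = ∏ i, z i ^ β i := by
  rw [← Finsupp.prod_fintype β (fun i a => z i ^ a) (fun _ => pow_zero _), ← h,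
    Finsupp.prod_mapDomain_index (fun _ => pow_zero _) (fun _ _ _ => pow_add _ _ _)]
  rfl

theorem eq_zero_of_scatteringWeight_ne_zero {α : ℕ →₀ ℕ} {r : ℕ → ℂ}
    (h : scatteringWeight α r ≠ 0) {i : ℕ} (hi : α i = 0) : α (i + 1) = 0 := by
  by_contra h0
  have hmem := Finset.le_sup (f := fun i : ℕ => i + 1) (Finsupp.mem_support_iff.mpr h0)
  refine h (mul_eq_zero_of_right _ (Finset.prod_eq_zero
    (Finset.mem_range.mpr ((Nat.lt_succ_self i).trans_le ((Nat.le_succ _).trans hmem))) ?_))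
  rw [hi]
  exact scatteringPoly_zero_left h0 _

/-- The support is an initial segment on which every entry is at least 1, so its length is at most
the degree. -/
theorem mem_indexSet_degree {α : ℕ →₀ ℕ} (h : ∀ i, α i = 0 → α (i + 1) = 0) :
    α ∈ indexSet α.degree := by
  intro i hi
  by_contra h0
  have hall : ∀ j ≤ i, α j ≠ 0 := fun j hj hj0 =>
    h0 (Nat.le_induction (P := fun k _ => α k = 0) hj0 (fun k _ => h k) i hj)
  have hsub : Finset.range (i + 1) ⊆ α.support := fun j hj =>
    Finsupp.mem_support_iff.mpr (hall j (Nat.lt_succ_iff.mp (Finset.mem_range.mp hj)))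
  have hcard : i + 1 ≤ α.support.card := by simpa using Finset.card_le_card hsub
  have hdeg : α.support.card ≤ α.degree := by
    rw [Finset.card_eq_sum_ones]
    exact Finset.sum_le_sum fun j hj => Nat.one_le_iff_ne_zero.mpr (Finsupp.mem_support_iff.mp hj)
  omega

theorem mem_indexSet_of_scatteringWeight_ne_zero {d : ℕ} {ν : ℕ → Fin d} {α : ℕ →₀ ℕ}
    {β : Fin d →₀ ℕ} {r : ℕ → ℂ} (hα : α.mapDomain ν = β) (h : scatteringWeight α r ≠ 0) :
    α ∈ indexSet β.degree := by
  rw [← hα, Finsupp.degree_mapDomain]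
  exact mem_indexSet_degree fun i => eq_zero_of_scatteringWeight_ne_zero h

theorem finite_setOf_mapDomain_eq {d : ℕ} (ν : ℕ → Fin d) (r : ℕ → ℂ) (β : Fin d →₀ ℕ) :
    {α : ℕ →₀ ℕ | α.mapDomain ν = β ∧ scatteringWeight α r ≠ 0}.Finite := by
  refine (Set.finite_Iic (Finsupp.indicator (Finset.range β.degree)
    fun _ _ => β.degree)).subset fun α hα i => ?_
  have hmem := mem_indexSet_of_scatteringWeight_ne_zero hα.1 hα.2
  by_cases hi : i < β.degree
  · rw [Finsupp.indicator_of_mem (Finset.mem_range.mpr hi), ← hα.1, Finsupp.degree_mapDomain]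
    exact Finsupp.le_degree i α
  · rw [hmem i (not_lt.mp hi)]
    exact Nat.zero_le _

/-- The coefficient of `z ^ β` in the sum of the terms with `α ∈ s`. -/
def taylorCoeff {d : ℕ} (ν : ℕ → Fin d) (r : ℕ → ℂ) (s : Set (ℕ →₀ ℕ)) (β : Fin d →₀ ℕ) : ℂ :=
  ∑ α ∈ (finite_setOf_mapDomain_eq ν r β).toFinset, s.indicator (fun α => scatteringWeight α r) α

/-- The unconditional sum over `A_n` is regrouped along the fibres of `α ↦ α.mapDomain ν`, each of
which has finitely many nonzero terms. -/
theorem hasSum_taylorCoeff {d : ℕ} {r : ℕ → ℂ} (hr : ∀ n, ‖r n‖ ≤ 1) (ν : ℕ → Fin d) (n : ℕ)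
    {z : Fin d → ℂ} (hz : z ∈ polydisk d) :
    HasSum (fun β => taylorCoeff ν r (indexSet n) β * ∏ i, z i ^ β i) (convergent r ν n z) := by
  classical
  have h := hasSum_indexSet hr ν n hz
  set g : (ℕ →₀ ℕ) → ℂ := fun α => scatteringWeight α r * allocMonomial ν α z
  have h1 : HasSum ((indexSet n).indicator g) (convergent r ν n z) :=
    (hasSum_subtype_iff_indicator (f := g)).mp h
  have h2 := (Equiv.sigmaFiberEquiv fun α : ℕ →₀ ℕ => α.mapDomain ν).hasSum_iff.mpr h1
  refine h2.sigma fun β => ?_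
  set S := (finite_setOf_mapDomain_eq ν r β).toFinset
  have hS : ∀ α, α ∈ S ↔ α.mapDomain ν = β ∧ scatteringWeight α r ≠ 0 :=
    fun α => Set.Finite.mem_toFinset _
  set T : Set (ℕ →₀ ℕ) := {α | α.mapDomain ν = β}
  have h3 : HasSum (T.indicator ((indexSet n).indicator g))
      (∑ α ∈ S, T.indicator ((indexSet n).indicator g) α) := by
    refine hasSum_sum_of_ne_finset_zero fun α hα => ?_
    rw [hS, not_and, not_not] at hα
    by_cases hT : α ∈ T
    · rw [Set.indicator_of_mem hT, Set.indicator_apply]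
      simp [g, hα hT]
    · exact Set.indicator_of_notMem hT _
  have h4 : ∑ α ∈ S, T.indicator ((indexSet n).indicator g) α =
      taylorCoeff ν r (indexSet n) β * ∏ i, z i ^ β i := by
    rw [taylorCoeff, Finset.sum_mul]
    refine Finset.sum_congr rfl fun α hα => ?_
    have hT : α.mapDomain ν = β := ((hS α).mp hα).1
    rw [Set.indicator_of_mem (s := T) hT, ← allocMonomial_eq_of_mapDomain_eq hT,
      Set.indicator_apply, Set.indicator_apply]
    split_ifs
    · rfl
    · rw [zero_mul]
  rw [h4] at h3
  exact (hasSum_subtype_iff_indicator (f := (indexSet n).indicator g) (s := T)).mpr h3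

theorem taylorCoeff_indexSet_eq {d : ℕ} (ν : ℕ → Fin d) (r : ℕ → ℂ) {β : Fin d →₀ ℕ} {n : ℕ}
    (hn : β.degree ≤ n) : taylorCoeff ν r (indexSet n) β = taylorCoeff ν r Set.univ β := by
  refine Finset.sum_congr rfl fun α hα => ?_
  have hα := (Set.Finite.mem_toFinset _).mp hα
  rw [Set.indicator_univ, Set.indicator_of_mem]
  exact fun i hi => mem_indexSet_of_scatteringWeight_ne_zero hα.1 hα.2 i (hn.trans hi)

/-- The bound on single weights does not suffice, since a fibre may hold many of them; Cauchy's
estimate is applied to the convergent itself. -/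
theorem norm_taylorCoeff_indexSet_le_one {d : ℕ} {r : ℕ → ℂ} (hr : ∀ n, ‖r n‖ ≤ 1)
    (ν : ℕ → Fin d) (n : ℕ) (β : Fin d →₀ ℕ) : ‖taylorCoeff ν r (indexSet n) β‖ ≤ 1 := by
  have h := norm_coeff_le_one
    (a := fun γ => taylorCoeff ν r (indexSet n) (Finsupp.equivFunOnFinite.symm γ))
    (F := convergent r ν n) (fun z hz => ?_) (fun z hz => norm_convergent_le_one hr ν n hz) β
  · simpa using h
  · have h := hasSum_taylorCoeff hr ν n hz
    rw [← Finsupp.equivFunOnFinite.symm.hasSum_iff] at h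
    exact h

theorem finsum_eq_taylorCoeff_mul {d : ℕ} (ν : ℕ → Fin d) (r : ℕ → ℂ) (β : Fin d →₀ ℕ)
    (z : Fin d → ℂ) :
    ∑ᶠ (α : ℕ →₀ ℕ) (_ : α.mapDomain ν = β), scatteringWeight α r * allocMonomial ν α z =
      taylorCoeff ν r Set.univ β * ∏ i, z i ^ β i := by
  have h := finsum_mem_eq_sum_of_inter_support_eq
    (fun α => scatteringWeight α r * allocMonomial ν α z) (s := {α | α.mapDomain ν = β})
    (t := (finite_setOf_mapDomain_eq ν r β).toFinset) (by
      ext α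
      simp only [Set.mem_inter_iff, Set.mem_ofPred_eq, Set.Finite.coe_toFinset,
        Function.mem_support, mul_ne_zero_iff]
      tauto)
  refine h.trans ?_
  rw [taylorCoeff, Finset.sum_mul]
  refine Finset.sum_congr rfl fun α hα => ?_
  rw [Set.indicator_univ,
    allocMonomial_eq_of_mapDomain_eq ((Set.Finite.mem_toFinset _).mp hα).1]

theorem summable_prod_pow_finsupp {d : ℕ} {x : Fin d → ℝ} (h0 : ∀ i, 0 ≤ x i)
    (h1 : ∀ i, x i < 1) : Summable fun β : Fin d →₀ ℕ => ∏ i, x i ^ β i := by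
  have h := summable_prod_pow h0 h1
  rw [← Finsupp.equivFunOnFinite.summable_iff] at h
  exact h

/-- Dominated convergence for series: each coefficient is eventually constant in `n`, and the
monomials with coefficient 1 dominate. -/
theorem hasSum_taylorCoeff_univ {d : ℕ} {r : ℕ → ℂ} (hr : ∀ n, ‖r n‖ ≤ 1) (ν : ℕ → Fin d)
    {z : Fin d → ℂ} (hz : z ∈ polydisk d) {v : ℂ}
    (hv : Tendsto (fun n => convergent r ν n z) atTop (𝓝 v)) :
    HasSum (fun β => taylorCoeff ν r Set.univ β * ∏ i, z i ^ β i) v := by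
  have hs := summable_prod_pow_finsupp (x := fun i => ‖z i‖) (fun _ => norm_nonneg _) hz
  have hb : ∀ n β, ‖taylorCoeff ν r (indexSet n) β * ∏ i, z i ^ β i‖ ≤ ∏ i, ‖z i‖ ^ β i := by
    intro n β
    rw [norm_mul, norm_prod]
    simp only [norm_pow]
    exact mul_le_of_le_one_left (Finset.prod_nonneg fun i _ => by positivity)
      (norm_taylorCoeff_indexSet_le_one hr ν n β)
  have hlim := tendsto_tsum_of_dominated_convergence
    (f := fun n β => taylorCoeff ν r (indexSet n) β * ∏ i, z i ^ β i)
    (g := fun β => taylorCoeff ν r Set.univ β * ∏ i, z i ^ β i) (𝓕 := atTop) hs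
    (fun β => tendsto_const_nhds.congr' (by
      filter_upwards [eventually_ge_atTop β.degree] with n hn
      rw [taylorCoeff_indexSet_eq ν r hn])) (.of_forall hb)
  simp only [(hasSum_taylorCoeff hr ν _ hz).tsum_eq] at hlim
  have hsum : Summable fun β => taylorCoeff ν r Set.univ β * ∏ i, z i ^ β i :=
    Summable.of_norm_bounded hs fun β => by
      rw [← taylorCoeff_indexSet_eq ν r le_rfl]
      exact hb _ β
  rw [tendsto_nhds_unique hv hlim]
  exact hsum.hasSum

theorem hasSumUniformlyOn_taylor {d : ℕ} {r : ℕ → ℂ} (hr : ∀ n, ‖r n‖ ≤ 1) (ν : ℕ → Fin d)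
    {f : (Fin d → ℂ) → ℂ} {K : Set (Fin d → ℂ)} (hK : K ⊆ polydisk d) (hc : IsCompact K)
    (hf : ∀ z ∈ K, Tendsto (fun n => convergent r ν n z) atTop (𝓝 (f z))) :
    HasSumUniformlyOn
      (fun (β : Fin d →₀ ℕ) (z : Fin d → ℂ) =>
        ∑ᶠ (α : ℕ →₀ ℕ) (_ : α.mapDomain ν = β), scatteringWeight α r * allocMonomial ν α z)
      f K := by
  simp only [finsum_eq_taylorCoeff_mul]
  obtain ⟨ρ, hρ0, hρ1, hρ⟩ := exists_subset_closedBall hK hc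
  have hs := summable_prod_pow_finsupp (x := fun _ : Fin d => ρ) (fun _ => by linarith)
    fun _ => hρ1
  refine (HasSumUniformlyOn.of_norm_le_summable hs fun β z hz => ?_).congr_right fun z hz =>
    (hasSum_taylorCoeff_univ hr ν (hK hz) (hf z hz)).tsum_eq
  rw [norm_mul, norm_prod, ← taylorCoeff_indexSet_eq ν r le_rfl]
  simp only [norm_pow]
  refine (mul_le_of_le_one_left (Finset.prod_nonneg fun i _ => by positivity)
      (norm_taylorCoeff_indexSet_le_one hr ν _ β)).trans (Finset.prod_le_prod
    (fun i _ => by positivity) fun i _ => pow_le_pow_left₀ (norm_nonneg _) ?_ _)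
  exact (norm_le_pi_norm z i).trans (hρ z hz)

/-! ### Locally uniform limits of holomorphic functions of several variables -/

/-- Cauchy's estimate makes the derivatives uniformly Cauchy on a smaller ball, where limit and
derivative may be interchanged. -/
theorem differentiableOn_of_uniformCauchySeqOn {E : Type*} [NormedAddCommGroup E]
    [NormedSpace ℂ E] {F : ℕ → E → ℂ} {g : E → ℂ} {U : Set E} (hU : IsOpen U)
    (hF : ∀ n, DifferentiableOn ℂ (F n) U) (hc : UniformCauchySeqOn F atTop U)
    (hg : ∀ x ∈ U, Tendsto (fun n => F n x) atTop (𝓝 (g x))) : DifferentiableOn ℂ g U := by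
  intro x hx
  obtain ⟨δ', hδ', hball⟩ := Metric.isOpen_iff.mp hU x hx
  set δ := δ' / 2
  have hδ : 0 < δ := half_pos hδ'
  have hsub : ∀ y ∈ Metric.ball x δ, Metric.ball y δ ⊆ U := fun y hy w hw => hball (by
    rw [Metric.mem_ball] at hy hw ⊢
    have := dist_triangle w y x
    simp only [δ] at hy hw
    linarith)
  have hdiff : ∀ n, ∀ y ∈ Metric.ball x δ, DifferentiableAt ℂ (F n) y := fun n y hy =>
    (hF n).differentiableAt (hU.mem_nhds (hsub y hy (Metric.mem_ball_self hδ)))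
  have hc' : UniformCauchySeqOn (fun n y => fderiv ℂ (F n) y) atTop (Metric.ball x δ) := by
    rw [Metric.uniformCauchySeqOn_iff] at hc ⊢
    intro ε hε
    obtain ⟨N, hN⟩ := hc (ε * δ / 4) (by positivity)
    refine ⟨N, fun m hm n hn y hy => ?_⟩
    have hd : DifferentiableOn ℂ (F m - F n) (Metric.ball y δ) :=
      ((hF m).sub (hF n)).mono (hsub y hy)
    have hb : ∀ w ∈ Metric.ball y δ, ‖F m w - F n w‖ < ε * δ / 4 := fun w hw => by
      rw [← dist_eq_norm]
      exact hN m hm n hn w (hsub y hy hw)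
    have h := Complex.norm_fderiv_le_div_of_mapsTo_ball (R₂ := ε * δ / 2) hd (fun w hw => by
      rw [mem_closedBall_iff_norm]
      refine (norm_sub_le _ _).trans ?_
      have h1 := hb w hw
      have h2 := hb y (Metric.mem_ball_self hδ)
      simp only [Pi.sub_apply]
      linarith) hδ
    rw [dist_eq_norm, ← fderiv_sub (hdiff m y hy) (hdiff n y hy)]
    refine h.trans_lt ?_
    rw [div_lt_iff₀ hδ]
    linarith [mul_pos hε hδ]
  have hex : ∀ y ∈ Metric.ball x δ, ∃ l, Tendsto (fun n => fderiv ℂ (F n) y) atTop (𝓝 l) :=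
    fun y hy => cauchySeq_tendsto_of_complete (hc'.cauchySeq hy)
  choose! g' hg' using hex
  exact (hasFDerivAt_of_tendstoUniformlyOn Metric.isOpen_ball
    (hc'.tendstoUniformlyOn_of_tendsto hg') (fun n y hy => (hdiff n y hy).hasFDerivAt)
    (fun y hy => hg y (hsub y hy (Metric.mem_ball_self hδ)))
    (Metric.mem_ball_self hδ)).differentiableAt.differentiableWithinAt

theorem isOpen_polydisk (d : ℕ) : IsOpen (polydisk d) := by
  rw [polydisk_eq_ball]
  exact Metric.isOpen_ball

theorem mem_polydisk_of_norm_le {d : ℕ} {z : Fin d → ℂ} {ρ : ℝ} (hz : ‖z‖ ≤ ρ) (hρ : ρ < 1) :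
    z ∈ polydisk d := fun i => ((norm_le_pi_norm z i).trans hz).trans_lt hρ

/-- Division by a coordinate that may vanish: the maximum principle in the `j`-th variable moves the
estimate to the circle of radius `ρ`, where the division costs `1 / ρ`. -/
theorem norm_le_div_of_norm_coord_mul_le {d : ℕ} {u : (Fin d → ℂ) → ℂ}
    (hu : DifferentiableOn ℂ u (polydisk d)) (j : Fin d) {ρ C : ℝ} (hρ0 : 0 < ρ) (hρ1 : ρ < 1)
    (hC : ∀ w : Fin d → ℂ, ‖w‖ ≤ ρ → ‖w j * u w‖ ≤ C) {z : Fin d → ℂ} (hz : ‖z‖ ≤ ρ) :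
    ‖u z‖ ≤ C / ρ := by
  have hupd : ∀ ζ : ℂ, ‖ζ‖ ≤ ρ → ‖Function.update z j ζ‖ ≤ ρ := fun ζ hζ => by
    rw [pi_norm_le_iff_of_nonneg hρ0.le]
    intro i
    rcases eq_or_ne i j with rfl | hij
    · rwa [Function.update_self]
    · rw [Function.update_of_ne hij]
      exact (norm_le_pi_norm z i).trans hz
  have hd : DifferentiableOn ℂ (fun ζ : ℂ => u (Function.update z j ζ))
      (Metric.closedBall 0 ρ) := fun ζ hζ => by
    have hmem := mem_polydisk_of_norm_le (hupd ζ (mem_closedBall_zero_iff.mp hζ)) hρ1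
    exact ((hu.differentiableAt ((isOpen_polydisk d).mem_nhds hmem)).comp ζ
      (hasDerivAt_update z j ζ).differentiableAt).differentiableWithinAt
  have h := Complex.norm_le_of_forall_mem_frontier_norm_le Metric.isBounded_ball
    (hd.diffContOnCl_ball subset_rfl) (C := C / ρ) (fun ζ hζ => ?_) (z := z j) ?_
  · simpa using h
  · rw [frontier_ball _ hρ0.ne', mem_sphere_zero_iff_norm] at hζ
    have h := hC _ (hupd ζ hζ.le)
    rw [Function.update_self, norm_mul, hζ] at h
    rwa [le_div_iff₀' hρ0]
  · rw [closure_ball _ hρ0.ne', mem_closedBall_zero_iff]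
    exact (norm_le_pi_norm z j).trans hz

/-! ### The Schur algorithm -/

theorem norm_coord_mul_lt_one {d : ℕ} {z : Fin d → ℂ} (hz : z ∈ polydisk d) (j : Fin d) {y : ℂ}
    (hy : ‖y‖ ≤ 1) : ‖z j * y‖ < 1 := by
  rw [norm_mul]
  exact (mul_le_of_le_one_right (norm_nonneg _) hy).trans_lt (hz j)

theorem mobVal_of_norm_lt_one {r : ℂ} (hr : ‖r‖ < 1) (x : ℂ) :
    mobVal r x = (x + r) / (1 + star r * x) := if_neg hr.ne

theorem SchurOrbit.mem_holClass {d : ℕ} {g : (Fin d → ℂ) → ℂ} (hg : SchurOrbit d g) :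
    g ∈ holClass d := by
  induction hg with
  | zero => exact ⟨differentiableOn_const _, fun z _ => by simp⟩
  | step r j h hr _ ih =>
    have hz : ∀ z ∈ polydisk d, ‖z j * h z‖ < 1 := fun z hz =>
      norm_coord_mul_lt_one hz j (ih.2 z hz)
    refine ⟨?_, fun z hz' => norm_mobVal_le_one hr.le (hz z hz').le⟩
    have hmul : DifferentiableOn ℂ (fun z : Fin d → ℂ => z j * h z) (polydisk d) :=
      (differentiable_apply j).differentiableOn.mul ih.1
    have hne : ∀ z ∈ polydisk d, 1 + star r * (z j * h z) ≠ 0 := fun z hz' =>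
      one_add_star_mul_ne_zero
        (by nlinarith [norm_nonneg r, norm_nonneg (z j * h z), hz z hz'])
    exact ((hmul.add_const r).mul (((hmul.const_mul (star r)).const_add 1).inv hne)).congr
      fun z _ => (mobVal_of_norm_lt_one hr _).trans (div_eq_mul_inv _ _)

theorem mobVal_neg_mobVal {r x : ℂ} (hr : ‖r‖ < 1) (hx : ‖x‖ < 1) :
    mobVal (-r) (mobVal r x) = x := by
  have h1 : 1 + star r * x ≠ 0 :=
    one_add_star_mul_ne_zero (by nlinarith [norm_nonneg r, norm_nonneg x])
  have h2 : 1 - star r * r ≠ 0 := by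
    have := one_add_star_mul_ne_zero (r := r) (x := -r) (by
      rw [norm_neg]; nlinarith [norm_nonneg r])
    rwa [mul_neg, ← sub_eq_add_neg] at this
  rw [mobVal_of_norm_lt_one (by rwa [norm_neg]), mobVal_of_norm_lt_one hr, star_neg]
  have e1 : (x + r) / (1 + star r * x) + -r = x * (1 - star r * r) / (1 + star r * x) := by
    rw [div_add' _ _ _ h1]
    congr 1
    ring
  have e2 : 1 + -star r * ((x + r) / (1 + star r * x)) = (1 - star r * r) / (1 + star r * x) := by
    rw [mul_div_assoc', add_div' _ _ _ h1]
    congr 1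
    ring
  rw [e1, e2, div_div_div_cancel_right₀ h1, mul_div_cancel_right₀ _ h2]

/-- Inverse Möbius maps are jointly Lipschitz in parameter and argument while the parameter stays
away from the circle; both denominators are at least `1 - R`. -/
theorem norm_mobVal_sub_mobVal_le {r s a b : ℂ} {R : ℝ} (hR : R < 1) (hr : ‖r‖ ≤ R)
    (hs : ‖s‖ ≤ R) (ha : ‖a‖ ≤ 1) (hb : ‖b‖ ≤ 1) :
    ‖mobVal (-r) a - mobVal (-s) b‖ ≤ (2 * ‖a - b‖ + 4 * ‖r - s‖) / (1 - R) ^ 2 := by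
  have hden : ∀ {t x : ℂ}, ‖t‖ ≤ R → ‖x‖ ≤ 1 → 1 - R ≤ ‖1 + star (-t) * x‖ := by
    intro t x ht hx
    have h1 : ‖star (-t) * x‖ ≤ R := by
      rw [norm_mul, norm_star, norm_neg]
      nlinarith [norm_nonneg t, norm_nonneg x]
    have h2 := norm_sub_le (1 + star (-t) * x) (star (-t) * x)
    rw [add_sub_cancel_right, norm_one] at h2
    linarith
  have hpos : 0 < 1 - R := by linarith
  have h1 := hden hr ha
  have h2 := hden hs hb
  have hr1 : ‖r‖ ≤ 1 := by linarith
  have hs1 : ‖s‖ ≤ 1 := by linarith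
  rw [mobVal_of_norm_lt_one (by rw [norm_neg]; linarith),
    mobVal_of_norm_lt_one (by rw [norm_neg]; linarith),
    div_sub_div _ _ (norm_pos_iff.mp (by linarith)) (norm_pos_iff.mp (by linarith)), norm_div,
    norm_mul]
  have hnum : (a + -r) * (1 + star (-s) * b) - (1 + star (-r) * a) * (b + -s) =
      (a - b) - (r - s) + star (r - s) * (a * b) + star s * r * (b - a) +
        a * (star s * (r - s) - s * star (r - s)) := by
    rw [star_neg, star_neg, star_sub]
    ring
  have hsr : ‖star s * r‖ ≤ 1 := by
    rw [norm_mul, norm_star]; exact mul_le_one₀ hs1 (norm_nonneg _) hr1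
  have hab : ‖a * b‖ ≤ 1 := by
    rw [norm_mul]; exact mul_le_one₀ ha (norm_nonneg _) hb
  have e1 : ‖star (r - s) * (a * b)‖ ≤ ‖r - s‖ := by
    rw [norm_mul, norm_star]
    exact mul_le_of_le_one_right (norm_nonneg _) hab
  have e2 : ‖star s * r * (b - a)‖ ≤ ‖a - b‖ := by
    rw [norm_mul, norm_sub_rev b a]
    exact mul_le_of_le_one_left (norm_nonneg _) hsr
  have e3 : ‖a * (star s * (r - s) - s * star (r - s))‖ ≤ 2 * ‖r - s‖ := by
    rw [norm_mul]
    have h3 := norm_sub_le (star s * (r - s)) (s * star (r - s))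
    rw [norm_mul, norm_mul, norm_star, norm_star] at h3
    nlinarith [norm_nonneg (r - s), norm_nonneg a,
      norm_nonneg (star s * (r - s) - s * star (r - s))]
  have hle : ‖(a + -r) * (1 + star (-s) * b) - (1 + star (-r) * a) * (b + -s)‖ ≤
      2 * ‖a - b‖ + 4 * ‖r - s‖ := by
    rw [hnum]
    refine (norm_add_le _ _).trans ?_
    have h4 := norm_add_le (a - b - (r - s) + star (r - s) * (a * b)) (star s * r * (b - a))
    have h5 := norm_add_le (a - b - (r - s)) (star (r - s) * (a * b))
    have h6 := norm_sub_le (a - b) (r - s)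
    linarith
  refine div_le_div₀ (by positivity) hle (by positivity) ?_
  rw [sq]
  exact mul_le_mul h1 h2 hpos.le (norm_nonneg _)

theorem SchurOrbit.exists_eq_mobOp {d : ℕ} [NeZero d] {g : (Fin d → ℂ) → ℂ}
    (hg : SchurOrbit d g) :
    ∃ (r : ℂ) (j : Fin d) (h : (Fin d → ℂ) → ℂ), ‖r‖ < 1 ∧ SchurOrbit d h ∧
      g = mobOp r (mulOp j h) := by
  cases hg with
  | zero =>
    refine ⟨0, 0, _, by simp, SchurOrbit.zero, ?_⟩
    funext z
    simp [mobOp, mulOp]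
  | step r j h hr hh => exact ⟨r, j, h, hr, hh, rfl⟩

theorem zero_mem_schurClass (d : ℕ) : (fun _ => 0) ∈ schurClass d :=
  ⟨SchurOrbit.zero.mem_holClass, fun _ _ _ _ hε => ⟨_, SchurOrbit.zero, fun _ _ => by simpa⟩⟩

theorem mem_schurClass_iff {d : ℕ} {f : (Fin d → ℂ) → ℂ} :
    f ∈ schurClass d ↔ f ∈ holClass d ∧ ∀ ρ < 1, ∀ ε > 0,
      ∃ g, SchurOrbit d g ∧ ∀ z : Fin d → ℂ, ‖z‖ ≤ ρ → ‖g z - f z‖ < ε := by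
  refine and_congr_right fun _ => ⟨fun h ρ hρ ε hε => ?_, fun h K hK hc ε hε => ?_⟩
  · obtain ⟨g, hg, hgf⟩ := h (Metric.closedBall 0 ρ)
      (fun z hz => mem_polydisk_of_norm_le (mem_closedBall_zero_iff.mp hz) hρ)
      (isCompact_closedBall _ _) ε hε
    exact ⟨g, hg, fun z hz => hgf z (mem_closedBall_zero_iff.mpr hz)⟩
  · obtain ⟨ρ, -, hρ1, hρ⟩ := exists_subset_closedBall hK hc
    obtain ⟨g, hg, hgf⟩ := h ρ hρ1 ε hε
    exact ⟨g, hg, fun z hz => hgf z (hρ z hz)⟩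

/-- A Schur function is approximated by functions in the orbit whose outermost operator uses a
fixed variable. -/
theorem exists_approx_of_mem_schurClass {d : ℕ} [NeZero d] {f : (Fin d → ℂ) → ℂ}
    (hf : f ∈ schurClass d) :
    ∃ (j : Fin d) (r : ℕ → ℂ) (h : ℕ → (Fin d → ℂ) → ℂ), (∀ k, ‖r k‖ < 1) ∧
      (∀ k, SchurOrbit d (h k)) ∧ ∀ ρ < 1, ∀ ε > 0, ∃ N, ∀ k ≥ N, ∀ z : Fin d → ℂ, ‖z‖ ≤ ρ →
        ‖mobVal (r k) (z j * h k z) - f z‖ < ε := by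
  have hlim : Tendsto (fun k : ℕ => 1 / ((k : ℝ) + 1)) atTop (𝓝 0) :=
    tendsto_one_div_add_atTop_nhds_zero_nat
  have hpos : ∀ k : ℕ, 0 < 1 / ((k : ℝ) + 1) := fun k => by positivity
  have hanti : ∀ {k l : ℕ}, k ≤ l → 1 / ((l : ℝ) + 1) ≤ 1 / ((k : ℝ) + 1) := fun hkl =>
    one_div_le_one_div_of_le (by positivity) (by gcongr)
  have hj : ∃ j : Fin d, ∀ k : ℕ, ∃ (r : ℂ) (h : (Fin d → ℂ) → ℂ), ‖r‖ < 1 ∧ SchurOrbit d h ∧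
      ∀ z : Fin d → ℂ, ‖z‖ ≤ 1 - 1 / ((k : ℝ) + 1) →
        ‖mobVal r (z j * h z) - f z‖ < 1 / ((k : ℝ) + 1) := by
    by_contra! hcon
    choose k hk using hcon
    -- Pigeonhole: if every variable `j` failed at some precision `k j`, an orbit element of the
    -- largest precision would contradict the failure of its own outermost variable.
    set l := Finset.univ.sup k
    obtain ⟨g, hg, hgf⟩ := (mem_schurClass_iff.mp hf).2 (1 - 1 / ((l : ℝ) + 1))
      (by linarith [hpos l]) _ (hpos l)
    obtain ⟨r, j, h, hr, hh, rfl⟩ := hg.exists_eq_mobOp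
    obtain ⟨z, hz, hzf⟩ := hk j r h hr hh
    have hkl : k j ≤ l := Finset.le_sup (Finset.mem_univ j)
    have h1 := hgf z (hz.trans (by linarith [hanti hkl]))
    exact absurd (h1.trans_le (hanti hkl)) (not_lt.mpr hzf)
  obtain ⟨j, hj⟩ := hj
  choose r h hr hh happ using hj
  refine ⟨j, r, h, hr, hh, fun ρ hρ ε hε => ?_⟩
  obtain ⟨N, hN⟩ := eventually_atTop.mp
    ((hlim.eventually (gt_mem_nhds hε)).and (hlim.eventually (gt_mem_nhds (sub_pos.mpr hρ))))
  refine ⟨N, fun k hk z hz => (happ k z (hz.trans ?_)).trans (hN k hk).1⟩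
  linarith [(hN k hk).2]

theorem eqOn_const_of_norm_zero_eq_one {d : ℕ} {f : (Fin d → ℂ) → ℂ} (hf : f ∈ holClass d)
    (h0 : ‖f 0‖ = 1) : ∀ z ∈ polydisk d, f z = f 0 := by
  refine Complex.eqOn_of_isPreconnected_of_isMaxOn_norm ?_ (isOpen_polydisk d) hf.1
    (zero_mem_polydisk d) fun z hz => ?_
  · rw [polydisk_eq_ball]
    exact (convex_ball _ _).isPreconnected
  · simpa [h0] using hf.2 z hz

/-- Undoing the Möbius maps in the approximants makes `z_j h_k` uniformly Cauchy on smaller closed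
polydisks; dividing by `z_j` gives the same for `h_k`, whose limit is the next function. -/
theorem exists_schur_step_of_norm_lt_one {d : ℕ} [NeZero d] {f : (Fin d → ℂ) → ℂ}
    (hf : f ∈ schurClass d) (h0 : ‖f 0‖ < 1) :
    ∃ (j : Fin d) (h : (Fin d → ℂ) → ℂ), h ∈ schurClass d ∧
      Set.EqOn f (mobOp (f 0) (mulOp j h)) (polydisk d) := by
  obtain ⟨j, r, h, hr, hh, happ⟩ := exists_approx_of_mem_schurClass hf
  have hhol := fun k => (hh k).mem_holClass
  obtain ⟨R, hR0, hR1⟩ := exists_between h0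
  have hr0 : ∀ ε > 0, ∃ N, ∀ k ≥ N, ‖r k - f 0‖ < ε := fun ε hε => by
    obtain ⟨N, hN⟩ := happ 0 one_pos ε hε
    refine ⟨N, fun k hk => ?_⟩
    have := hN k hk 0 (by simp)
    rwa [Pi.zero_apply, zero_mul, mobVal_zero] at this
  obtain ⟨N₀, hN₀⟩ := hr0 (R - ‖f 0‖) (sub_pos.mpr hR0)
  have hrR : ∀ k ≥ N₀, ‖r k‖ ≤ R := fun k hk => by
    have h1 := norm_sub_norm_le (r k) (f 0)
    linarith [hN₀ k hk]
  have hcauchy : ∀ ρ : ℝ, 1 / 2 ≤ ρ → ρ < 1 → ∀ ε > 0, ∃ N, ∀ k ≥ N, ∀ l ≥ N,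
      ∀ z : Fin d → ℂ, ‖z‖ ≤ ρ → ‖h k z - h l z‖ ≤ ε := by
    intro ρ hρ0 hρ1 ε hε
    have hRpos : 0 < 1 - R := by linarith
    -- Values and parameters each differ by less than `2δ`, so the Lipschitz numerator is below
    -- `2·2δ + 4·2δ = 12δ`, that is `(ε/2)(1 - R)²`.
    set δ := ε * (1 - R) ^ 2 / 24
    have hδ : 0 < δ := by positivity
    obtain ⟨N₁, hN₁⟩ := happ ρ hρ1 δ hδ
    obtain ⟨N₂, hN₂⟩ := hr0 δ hδ
    refine ⟨max N₀ (max N₁ N₂), fun k hk l hl z hz => ?_⟩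
    rw [ge_iff_le, max_le_iff, max_le_iff] at hk hl
    have hmain : ∀ w : Fin d → ℂ, ‖w‖ ≤ ρ → ‖w j * (h k w - h l w)‖ ≤ ε / 2 := fun w hw => by
      have hwp := mem_polydisk_of_norm_le hw hρ1
      have hlt : ∀ m, ‖w j * h m w‖ < 1 := fun m =>
        norm_coord_mul_lt_one hwp j ((hhol m).2 w hwp)
      rw [mul_sub, ← mobVal_neg_mobVal (hr k) (hlt k), ← mobVal_neg_mobVal (hr l) (hlt l)]
      refine (norm_mobVal_sub_mobVal_le hR1 (hrR k hk.1) (hrR l hl.1)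
        (norm_mobVal_le_one (hr k).le (hlt k).le)
        (norm_mobVal_le_one (hr l).le (hlt l).le)).trans ?_
      have h1 := norm_sub_le_norm_sub_add_norm_sub (mobVal (r k) (w j * h k w)) (f w)
        (mobVal (r l) (w j * h l w))
      have h2 := norm_sub_le_norm_sub_add_norm_sub (r k) (f 0) (r l)
      rw [norm_sub_rev (f w)] at h1
      rw [norm_sub_rev (f 0)] at h2
      have h3 := hN₁ k hk.2.1 w hw
      have h4 := hN₁ l hl.2.1 w hw
      have h5 := hN₂ k hk.2.2
      have h6 := hN₂ l hl.2.2
      rw [div_le_iff₀ (by positivity)]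
      have h7 : ε / 2 * (1 - R) ^ 2 = 12 * δ := by simp only [δ]; ring
      linarith
    refine (norm_le_div_of_norm_coord_mul_le (u := fun w => h k w - h l w)
      ((hhol k).1.sub (hhol l).1) j (by linarith) hρ1 hmain hz).trans ?_
    -- Since `ρ ≥ 1/2`, dividing `ε / 2` by `ρ` gives at most `ε`.
    rw [div_le_iff₀ (by linarith)]
    nlinarith
  have hex : ∀ z ∈ polydisk d, ∃ v, Tendsto (fun k => h k z) atTop (𝓝 v) := fun z hz => by
    refine cauchySeq_tendsto_of_complete (Metric.cauchySeq_iff.mpr fun ε hε => ?_)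
    obtain ⟨ρ, hρ0, hρ1, hρ⟩ := exists_subset_closedBall (Set.singleton_subset_iff.mpr hz)
      isCompact_singleton
    obtain ⟨N, hN⟩ := hcauchy ρ hρ0 hρ1 (ε / 2) (half_pos hε)
    refine ⟨N, fun k hk l hl => ?_⟩
    rw [dist_eq_norm]
    exact (hN k hk l hl z (hρ z rfl)).trans_lt (half_lt_self hε)
  choose! H hH using hex
  have hdiff : DifferentiableOn ℂ H (polydisk d) := fun z hz => by
    obtain ⟨ρ', hρ0', hρ1', hρ'⟩ := exists_subset_closedBall (Set.singleton_subset_iff.mpr hz)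
      isCompact_singleton
    obtain ⟨ρ, hρ0, hρ1⟩ := exists_between hρ1'
    have hsub : Metric.ball 0 ρ ⊆ polydisk d := fun w hw =>
      mem_polydisk_of_norm_le (mem_ball_zero_iff.mp hw).le hρ1
    have hzρ : z ∈ Metric.ball 0 ρ := mem_ball_zero_iff.mpr ((hρ' z rfl).trans_lt hρ0)
    refine ((differentiableOn_of_uniformCauchySeqOn Metric.isOpen_ball
      (fun k => (hhol k).1.mono hsub) (Metric.uniformCauchySeqOn_iff.mpr fun ε hε => ?_)
      fun w hw => hH w (hsub hw)).differentiableAt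
      (Metric.isOpen_ball.mem_nhds hzρ)).differentiableWithinAt
    obtain ⟨N, hN⟩ := hcauchy ρ (hρ0'.trans hρ0.le) hρ1 (ε / 2) (half_pos hε)
    refine ⟨N, fun k hk l hl w hw => ?_⟩
    rw [dist_eq_norm]
    exact (hN k hk l hl w (mem_ball_zero_iff.mp hw).le).trans_lt (half_lt_self hε)
  have hbound : ∀ z ∈ polydisk d, ‖H z‖ ≤ 1 := fun z hz =>
    le_of_tendsto (hH z hz).norm (.of_forall fun k => (hhol k).2 z hz)
  refine ⟨j, H, mem_schurClass_iff.mpr ⟨⟨hdiff, hbound⟩, fun ρ hρ ε hε => ?_⟩, fun z hz => ?_⟩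
  · obtain ⟨N, hN⟩ := hcauchy (max ρ (1 / 2)) (le_max_right _ _) (max_lt hρ (by norm_num))
      (ε / 2) (half_pos hε)
    refine ⟨h N, hh N, fun z hz => ?_⟩
    have hz' := hz.trans (le_max_left ρ (1 / 2))
    have hzp := mem_polydisk_of_norm_le hz hρ
    refine (le_of_tendsto (tendsto_const_nhds.sub (hH z hzp)).norm ?_).trans_lt
      (half_lt_self hε)
    filter_upwards [eventually_ge_atTop N] with l hl
    exact hN N le_rfl l hl z hz'
  · obtain ⟨ρ, hρ0, hρ1, hρ⟩ := exists_subset_closedBall (Set.singleton_subset_iff.mpr hz)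
      isCompact_singleton
    have hlim1 : Tendsto (fun k => mobVal (r k) (z j * h k z)) atTop (𝓝 (f z)) := by
      rw [Metric.tendsto_atTop]
      intro ε hε
      obtain ⟨N, hN⟩ := happ ρ hρ1 ε hε
      refine ⟨N, fun k hk => ?_⟩
      rw [dist_eq_norm]
      exact hN k hk z (hρ z rfl)
    have hlimr : Tendsto r atTop (𝓝 (f 0)) := by
      rw [Metric.tendsto_atTop]
      intro ε hε
      obtain ⟨N, hN⟩ := hr0 ε hε
      refine ⟨N, fun k hk => ?_⟩
      rw [dist_eq_norm]
      exact hN k hk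
    have hlimx : Tendsto (fun k => z j * h k z) atTop (𝓝 (z j * H z)) := (hH z hz).const_mul _
    have hne : 1 + star (f 0) * (z j * H z) ≠ 0 := one_add_star_mul_ne_zero (by
      nlinarith [norm_nonneg (f 0), norm_nonneg (z j * H z),
        norm_coord_mul_lt_one hz j (hbound z hz)])
    have hlim2 := (hlimx.add hlimr).div
      (tendsto_const_nhds.add (hlimr.star.mul hlimx)) hne
    have heq := tendsto_nhds_unique hlim1
      (hlim2.congr fun k => (mobVal_of_norm_lt_one (hr k) _).symm)
    exact heq.trans (mobVal_of_norm_lt_one h0 _).symm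

theorem exists_schur_step {d : ℕ} [NeZero d] {f : (Fin d → ℂ) → ℂ} (hf : f ∈ schurClass d) :
    ∃ (j : Fin d) (h : (Fin d → ℂ) → ℂ), h ∈ schurClass d ∧
      Set.EqOn f (mobOp (f 0) (mulOp j h)) (polydisk d) ∧
      ((∃ c : ℂ, ∀ z ∈ polydisk d, f z = c) → j = 0 ∧ ∀ z ∈ polydisk d, h z = 0) := by
  by_cases hc : ∃ c : ℂ, ∀ z ∈ polydisk d, f z = c
  · refine ⟨0, _, zero_mem_schurClass d, fun z hz => ?_, fun _ => ⟨rfl, fun _ _ => rfl⟩⟩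
    obtain ⟨c, hc⟩ := hc
    rw [hc z hz, hc 0 (zero_mem_polydisk d)]
    simp [mobOp, mulOp]
  -- By the maximum modulus principle, only a constant can have modulus 1 at the origin.
  · have h0 : ‖f 0‖ < 1 := lt_of_le_of_ne (hf.1.2 _ (zero_mem_polydisk d)) fun h =>
      hc ⟨f 0, eqOn_const_of_norm_zero_eq_one hf.1 h⟩
    obtain ⟨j, h, hh, heq⟩ := exists_schur_step_of_norm_lt_one hf h0
    exact ⟨j, h, hh, heq, fun h => absurd h hc⟩

theorem exists_isContinuedFraction {d : ℕ} [NeZero d] {f : (Fin d → ℂ) → ℂ}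
    (hf : f ∈ schurClass d) :
    ∃ (r : ℕ → ℂ) (ν : ℕ → Fin d) (h : ℕ → (Fin d → ℂ) → ℂ), IsContinuedFraction f r ν h := by
  choose j T hT heq hconst using fun g : schurClass d => exists_schur_step g.2
  let H : ℕ → schurClass d := fun n => (fun g => ⟨T g, hT g⟩)^[n] ⟨f, hf⟩
  have hsucc : ∀ n, (H (n + 1)).1 = T (H n) := fun n =>
    congrArg Subtype.val (Function.iterate_succ_apply' _ _ _)
  refine ⟨fun n => (H n).1 0, fun n => j (H n), fun n => (H n).1, rfl, fun n => (H n).2,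
    fun n => rfl, fun n => ?_, fun n hn => ?_⟩
  · rw [hsucc]
    exact heq (H n)
  · rw [hsucc]
    exact hconst (H n) hn

end

theorem mainTheorem5 (d : ℕ) [NeZero d] (f : (Fin d → ℂ) → ℂ) (hf : f ∈ schurClass d) :
    -- `f` has a continued fraction expansion
    (∃ (r : ℕ → ℂ) (ν : ℕ → Fin d) (h : ℕ → (Fin d → ℂ) → ℂ), IsContinuedFraction f r ν h) ∧
    -- and for every such expansion:
    ∀ (r : ℕ → ℂ) (ν : ℕ → Fin d) (h : ℕ → (Fin d → ℂ) → ℂ), IsContinuedFraction f r ν h →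
      -- the convergents tend to `f`, uniformly on compact sets;
      (∀ K ⊆ polydisk d, IsCompact K →
        TendstoUniformlyOn (fun n => convergent r ν n) f atTop K) ∧
      -- the sum over `A_n` converges unconditionally, uniformly on compact sets, to the
      -- `n`-th convergent (so that the sums over `A_n` tend to `f`);
      (∀ n, ∀ K ⊆ polydisk d, IsCompact K →
        HasSumUniformlyOn
          (fun (α : indexSet n) (z : Fin d → ℂ) => scatteringWeight α r * allocMonomial ν α z)
          (convergent r ν n) K) ∧
      -- each monomial in `z` occurs in only finitely many nonzero terms of the sum over `A`;
      (∀ β : Fin d →₀ ℕ,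
        {α : ℕ →₀ ℕ | α.mapDomain ν = β ∧ scatteringWeight α r ≠ 0}.Finite) ∧
      -- the sum over `A`, with the terms of each monomial collected, converges unconditionally
      -- to `f`, uniformly on compact sets
      (∀ K ⊆ polydisk d, IsCompact K →
        HasSumUniformlyOn
          (fun (β : Fin d →₀ ℕ) (z : Fin d → ℂ) =>
            ∑ᶠ (α : ℕ →₀ ℕ) (_ : α.mapDomain ν = β), scatteringWeight α r * allocMonomial ν α z)
          f K) := by
  refine ⟨exists_isContinuedFraction hf, fun r ν h hcf => ?_⟩
  have hr := hcf.norm_param_le_one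
  refine ⟨fun K hK hc => hcf.tendstoUniformlyOn hK hc,
    fun n K hK hc => hasSumUniformlyOn_indexSet hr ν n hK hc,
    finite_setOf_mapDomain_eq ν r, fun K hK hc => ?_⟩
  exact hasSumUniformlyOn_taylor hr ν hK hc fun z hz =>
    (hcf.tendstoUniformlyOn hK hc).tendsto_at hz
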